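/- **Setting.** A buyer has a value $v\ge 0$ drawn from a distribution $D$ on $[0,\infty)$ with density $f$ and CDF $F$. Let $\Gamma_D(z)=z(1-F(z))$ and let $\varphi_D(v)=v-\frac{1-F(v)}{f(v)}$ (with value $-\infty$ where $f(v)=0$ and $F(v)<1$). $D$ is *regular* if $\varphi_D$ is non-decreasing on $\{v\ge 0: F(v)<1\}$, and *DMR* if $\varphi_D(v)f(v)=vf(v)-(1-F(v))$ is non-decreasing on $\{v\ge 0:F(v)<1\}$. A *mechanism* is a pricing function $M:[0,1]\to[0,\infty]$ with $M(0)=0$ that is non-decreasing, and continuous and convex on $[0,\bar x]$, where $\bar x=\sup\{x: M(x)<\infty\}$; the buyer may choose any $x$ with $M(x)<\infty$, pays $M(x)$ and gets the good with probability $x$. The *lottery with price $p$ and probability $z$* is $M(x)=px$ for $x\le z$, $M(x)=\infty$ for $x>z$. $\mathrm{Rev}(D)$ is the supremum, over mechanisms $M$, of the expected payment of a utility-maximizing buyer who faces only $M$. Two sellers, Alice and Bob, each sell a copy of the same good by mechanisms $A$ and $B$. The buyer wants one copy. Knowing $v,A,B$, the buyer chooses which seller to visit first, an option $a$ of $A$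 and an option $b$ of $B$; the option of the second seller is bought only if the first one did not deliver the good. With Bob first, the expected utility is $bv-B(b)+(1-b)(av-A(a))$; with Alice first, it is $av-A(a)+(1-a)(bv-B(b))$. The buyer maximizes expected utility, breaks ties first in favor of the larger expected allocation from Bob, then in favor of the larger expected allocation from Alice; if a tie remains, an arbitrary fixed rule decides. Let $\mathsf{rev}_{\mathsf A,(A,B)}(D)$ and $\mathsf{rev}_{\mathsf B,(A,B)}(D)$ be the resulting expected payments to Alice and to Bob. $B$ is a *best response* to $A$ if it maximizes $\mathsf{rev}_{\mathsf B,(A,\cdot)}(D)$ over all mechanisms. A mechanism $A$ and a map $\mathbb M$ from mechanisms to mechanisms form a *Stackelberg equilibrium* if $\mathbb M(A')$ is a best response to $A'$ for every $A'$, and $A$ maximizes $A'\mapsto \mathsf{rev}_{\mathsf A,(A',\mathbb M(A'))}(D)$. **Theorem.** Let $D$ be regular or DMR, and let $\mathtt v\ge 0$ be a maximizer of $\Gamma_D$ on $[0,\infty)$ (a Myerson price; its existence is assumed). Then $\mathrm{Rev}(D)=\Gamma_D(\mathtt v)$. There is a smallest $p\in[0,\mathtt v]$ with $\Gamma_D(p)=\Gamma_D(\mathtt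 v)/2$, and it has the following properties. 1. If $A$ is the lottery with price $p$ and probability $1/2$, then Bob has a best response $B$ to $A$ with $$\mathsf{rev}_{\mathsf A,(A,B)}(D)\ge \tfrac14\Gamma_D(\mathtt v)\quad\text{and}\quad \mathsf{rev}_{\mathsf B,(A,B)}(D)\ge\tfrac12\Gamma_D(\mathtt v).$$ 2. For every $\varepsilon>0$ there is $\delta>0$ such that for every $p'\ge 0$ with $p-\delta<p'<p$, if $A'$ is the lottery with price $p'$ and probability $1/2$, then Bob has a best response to $A'$, and every best response $B$ of Bob to $A'$ satisfies $$\mathsf{rev}_{\mathsf A,(A',B)}(D)\ge \tfrac14\Gamma_D(\mathtt v)-\varepsilon\quad\text{and}\quad \mathsf{rev}_{\mathsf B,(A',B)}(D)\ge\tfrac12\Gamma_D(\mathtt v)-\varepsilon.$$ Consequently the supremum of $\mathsf{rev}_{\mathsf A,(A,B)}(D)$ over all mechanisms $A$ and all best responses $B$ to $A$ is at least $\mathrm{Rev}(D)/4$, and in every Stackelberg equilibrium $(A,\mathbb M)$ Alice's revenue $\mathsf{rev}_{\mathsf A,(A,\mathbb M(A))}(D)$ is at least $\mathrm{Rev}(D)/4$.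 -/

import Mathlib

open MeasureTheory ProbabilityTheory Set Filter Topology
open scoped NNReal ENNReal

noncomputable section

/-! ### The value distribution -/

/-- `f` is a (real-valued, nonnegative, measurable) density of `D`. -/
def IsDensity (D : Measure ℝ) (f : ℝ → ℝ) : Prop :=
  Measurable f ∧ (∀ v, 0 ≤ f v) ∧ D = volume.withDensity (fun v => ENNReal.ofReal (f v))

/-- The revenue curve `Γ_D(z) = z (1 - F(z))`. -/
def revenueCurve (D : Measure ℝ) (z : ℝ) : ℝ := z * (1 - cdf D z)

/-- The set of nonnegative values that are not yet beyond the top of the distribution. It includes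
the values below the support. -/
def valueRange (D : Measure ℝ) : Set ℝ := {v | 0 ≤ v ∧ cdf D v < 1}

/-- The virtual value `v - (1 - F(v)) / f(v)`. On `valueRange D` the numerator is positive, so that
the virtual value is `-∞` where the density vanishes. -/
def virtualValue (D : Measure ℝ) (f : ℝ → ℝ) (v : ℝ) : EReal :=
  if f v = 0 then ⊥ else ((v - (1 - cdf D v) / f v : ℝ) : EReal)

/-- Regularity: the virtual value is non-decreasing. -/
def IsRegularDist (D : Measure ℝ) (f : ℝ → ℝ) : Prop :=
  MonotoneOn (virtualValue D f) (valueRange D)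

/-- Diminishing marginal revenue: virtual value times density, that is
`v f(v) - (1 - F(v))`, is non-decreasing. -/
def IsDMRDist (D : Measure ℝ) (f : ℝ → ℝ) : Prop :=
  MonotoneOn (fun v => v * f v - (1 - cdf D v)) (valueRange D)

/-! ### Mechanisms as proper pricing functions -/

/-- The largest probability offered at a finite price. -/
def maxProb (M : ℝ → ℝ≥0∞) : ℝ := sSup {x | x ∈ Icc (0 : ℝ) 1 ∧ M x < ⊤}

/-- A mechanism: a proper pricing function on `[0, 1]` with values in `[0, ∞]`. The values of
`price` outside `[0, 1]` are never used. -/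
structure Mechanism where
  price : ℝ → ℝ≥0∞
  price_zero : price 0 = 0
  monotoneOn : MonotoneOn price (Icc 0 1)
  continuousOn : ContinuousOn price (Icc 0 (maxProb price))
  convexOn : ConvexOn ℝ≥0 (Icc 0 (maxProb price)) price

/-- The pricing function of a single lottery: `x ↦ p x` on `[0, z]` and `∞` beyond `z`. -/
def lotteryPrice (p : ℝ≥0) (z : ℝ) (x : ℝ) : ℝ≥0∞ :=
  if x ≤ z then p * ENNReal.ofReal x else ⊤

theorem maxProb_lotteryPrice (p : ℝ≥0) (z : ℝ) (hz : z ∈ Icc (0 : ℝ) 1) :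
    maxProb (lotteryPrice p z) = z := by
  have h : {x | x ∈ Icc (0 : ℝ) 1 ∧ lotteryPrice p z x < ⊤} = Icc 0 z := by
    ext x
    simp only [lotteryPrice, mem_ofPred_eq, mem_Icc]
    constructor
    · rintro ⟨⟨h0, _⟩, h⟩
      refine ⟨h0, ?_⟩
      by_contra hx
      simp [hx] at h
    · rintro ⟨h0, hx⟩
      exact ⟨⟨h0, hx.trans hz.2⟩, by simp [hx, ENNReal.mul_lt_top]⟩
  rw [maxProb, h, csSup_Icc hz.1]

/-- The single-lottery mechanism with price `p` and probability `z`: a buyer who takes the lottery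
pays `p z` in expectation. -/
def lottery (p : ℝ≥0) (z : ℝ) (hz : z ∈ Icc (0 : ℝ) 1) : Mechanism where
  price := lotteryPrice p z
  price_zero := by simp [lotteryPrice, hz.1]
  monotoneOn := by
    intro x _ y _ hxy
    by_cases hy : y ≤ z
    · have hx : x ≤ z := hxy.trans hy
      simp only [lotteryPrice, hx, hy, if_true]
      gcongr
    · simp [lotteryPrice, hy]
  continuousOn := by
    rw [maxProb_lotteryPrice p z hz]
    have h : ContinuousOn (fun x : ℝ => (p : ℝ≥0∞) * ENNReal.ofReal x) (Icc 0 z) :=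
      ((ENNReal.continuous_const_mul ENNReal.coe_ne_top).comp
        ENNReal.continuous_ofReal).continuousOn
    refine h.congr ?_
    intro x hx
    simp [lotteryPrice, hx.2]
  convexOn := by
    rw [maxProb_lotteryPrice p z hz]
    have hconv : ∀ ⦃x⦄, x ∈ Icc (0 : ℝ) z → ∀ ⦃y⦄, y ∈ Icc (0 : ℝ) z → ∀ ⦃a b : ℝ≥0⦄,
        a + b = 1 → a • x + b • y ∈ Icc (0 : ℝ) z := by
      intro x hx y hy a b hab
      have hab' : (a : ℝ) + b = 1 := by exact_mod_cast hab
      simp only [NNReal.smul_def, smul_eq_mul, mem_Icc]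
      constructor
      · have h1 := mul_nonneg a.2 hx.1
        have h2 := mul_nonneg b.2 hy.1
        exact add_nonneg h1 h2
      · have h1 := mul_le_mul_of_nonneg_left hx.2 a.2
        have h2 := mul_le_mul_of_nonneg_left hy.2 b.2
        calc (a : ℝ) * x + b * y ≤ a * z + b * z := add_le_add h1 h2
          _ = z := by rw [← add_mul, hab', one_mul]
    refine ⟨fun x hx y hy a b _ _ hab => hconv hx hy hab, ?_⟩
    intro x hx y hy a b _ _ hab
    have hm := hconv hx hy hab
    simp only [lotteryPrice, hx.2, hy.2, hm.2, if_true]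
    simp only [NNReal.smul_def, smul_eq_mul, ENNReal.smul_def]
    rw [ENNReal.ofReal_add (mul_nonneg a.coe_nonneg hx.1) (mul_nonneg b.coe_nonneg hy.1),
      ENNReal.ofReal_mul a.coe_nonneg, ENNReal.ofReal_mul b.coe_nonneg,
      ENNReal.ofReal_coe_nnreal, ENNReal.ofReal_coe_nnreal]
    apply le_of_eq
    ring

/-! ### The monopolist -/

/-- `x` maximizes the utility of a buyer of value `v` who faces only the mechanism `M`. -/
def IsMonopolyChoice (M : Mechanism) (v x : ℝ) : Prop :=
  x ∈ Icc (0 : ℝ) 1 ∧ M.price x ≠ ⊤ ∧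
    ∀ y ∈ Icc (0 : ℝ) 1, M.price y ≠ ⊤ →
      v * y - (M.price y).toReal ≤ v * x - (M.price x).toReal

/-- `Rev(D)`: the optimal expected revenue of a single seller. -/
def monopolyRev (D : Measure ℝ) : ℝ≥0∞ :=
  sSup {r | ∃ (M : Mechanism) (x : ℝ → ℝ), (∀ v, 0 ≤ v → IsMonopolyChoice M v (x v)) ∧
    r = ∫⁻ v, M.price (x v) ∂D}

/-! ### The buyer in the duopoly -/

/-- A strategy of the buyer: the seller to be visited first, the probability `a` bought from Alice
and the probability `b` bought from Bob. The purchase from the seller visited second takes place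
only if the first seller did not allocate the good. -/
structure BuyerPlan where
  bobFirst : Bool
  a : ℝ
  b : ℝ

namespace BuyerPlan

def Feasible (A B : Mechanism) (s : BuyerPlan) : Prop :=
  s.a ∈ Icc (0 : ℝ) 1 ∧ s.b ∈ Icc (0 : ℝ) 1 ∧ A.price s.a ≠ ⊤ ∧ B.price s.b ≠ ⊤

/-- The probability that Alice is visited and the purchase at her shop takes place. -/
def reachA (s : BuyerPlan) : ℝ := if s.bobFirst then 1 - s.b else 1

/-- The probability that Bob is visited and the purchase at his shop takes place. -/
def reachB (s : BuyerPlan) : ℝ := if s.bobFirst then 1 else 1 - s.a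

/-- Expected allocation from Alice. -/
def allocA (s : BuyerPlan) : ℝ := s.reachA * s.a

/-- Expected allocation from Bob. -/
def allocB (s : BuyerPlan) : ℝ := s.reachB * s.b

/-- Expected payment to Alice. -/
def payA (A : Mechanism) (s : BuyerPlan) : ℝ := s.reachA * (A.price s.a).toReal

/-- Expected payment to Bob. -/
def payB (B : Mechanism) (s : BuyerPlan) : ℝ := s.reachB * (B.price s.b).toReal

/-- Expected utility of a buyer of value `v`. -/
def utility (A B : Mechanism) (v : ℝ) (s : BuyerPlan) : ℝ :=
  v * (s.allocA + s.allocB) - s.payA A - s.payB B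

/-- `s` maximizes the expected utility; ties are broken first in favor of the larger expected
allocation from Bob, then in favor of the larger expected allocation from Alice. -/
def Optimal (A B : Mechanism) (v : ℝ) (s : BuyerPlan) : Prop :=
  s.Feasible A B ∧ ∀ t : BuyerPlan, t.Feasible A B →
    t.utility A B v < s.utility A B v ∨
      (t.utility A B v = s.utility A B v ∧
        (t.allocB < s.allocB ∨ (t.allocB = s.allocB ∧ t.allocA ≤ s.allocA)))

end BuyerPlan

/-- The buyer's behavior for all pairs of mechanisms (Alice's first) and all values. -/
abbrev BuyerRule := Mechanism → Mechanism → ℝ → BuyerPlan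

/-- The buyer always plays optimally, with the above tie-breaking. -/
def BuyerRule.IsOptimal (σ : BuyerRule) : Prop :=
  ∀ (A B : Mechanism) (v : ℝ), 0 ≤ v → (σ A B v).Optimal A B v

/-! ### The sellers in the duopoly -/

/-- Alice's expected revenue. -/
def revA (σ : BuyerRule) (D : Measure ℝ) (A B : Mechanism) : ℝ≥0∞ :=
  ∫⁻ v, ENNReal.ofReal ((σ A B v).payA A) ∂D

/-- Bob's expected revenue. -/
def revB (σ : BuyerRule) (D : Measure ℝ) (A B : Mechanism) : ℝ≥0∞ :=
  ∫⁻ v, ENNReal.ofReal ((σ A B v).payB B) ∂D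

/-- `B` is a best response of Bob to Alice's mechanism `A`. -/
def IsBestResponse (σ : BuyerRule) (D : Measure ℝ) (A B : Mechanism) : Prop :=
  ∀ B' : Mechanism, revB σ D A B' ≤ revB σ D A B

/-- Alice's mechanism `A` and Bob's strategy `R` (a map from Alice's mechanism to a mechanism of
Bob) form a Stackelberg equilibrium. -/
def IsStackelbergEquilibrium (σ : BuyerRule) (D : Measure ℝ) (A : Mechanism)
    (R : Mechanism → Mechanism) : Prop :=
  (∀ A' : Mechanism, IsBestResponse σ D A' (R A')) ∧
    ∀ A' : Mechanism, revA σ D A' (R A') ≤ revA σ D A (R A)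

/-- Alice's best Stackelberg revenue: the supremum of her revenue over her mechanisms and the best
responses of Bob. -/
def stackelbergRev (σ : BuyerRule) (D : Measure ℝ) : ℝ≥0∞ :=
  ⨆ (A : Mechanism) (B : Mechanism) (_ : IsBestResponse σ D A B), revA σ D A B

end

/-! ### Distributions with a density -/

namespace IsDensity

variable {D : Measure ℝ} {f : ℝ → ℝ}

/-! Let Alice sell the lottery with price `p` and probability 1/2, and let `U` be the indirect
utility of Bob's mechanism. A buyer of value w > p who visits Bob first gets (w - p)/2 + U((w +
p)/2): losing Alice's lottery lowers the effective value to (w + p)/2. Visiting Alice first gives (w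
- p)/2 + U(w)/2, and Bob is then reached half of the time. A buyer below `p` deals with Bob alone.

Since `U` is convex with slopes in [0, 1], it is the mixture ∫ (w - s)⁺ ν(ds) of posted prices
(`exists_measure_of_subgradient`). In this form U((w + p)/2) - U(w)/2 is -1/2 times the ν-integral
of `tent p w`, which is monotone in w. So either Bob is worth visiting first for all w > p, or there
is a threshold t: Bob first below it, Alice first above it, indifference at t itself.

Bob's revenue is bounded price by price (`mul_cdf_sub_add_le`): up to a multiple of `tent p t s`,
the price s brings at most Γ(p) if s ≤ (t + p)/2 and at most Γ(v)/2 otherwise. By indifference the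
`tent` term integrates to zero, like a constraint with its Lagrange multiplier. The multiplier comes
from a supergradient of Γ at `p` (`IsDensity.exists_supergradient`), the only place where regularity
or DMR enters. Without a threshold, Bob gets at most Γ(p).

Hence if Γ(p) ≤ Γ(v)/2, Bob gets at most Γ(v)/2, and the posted price `v` attains this. If Γ(p) <
Γ(v)/2, any best response sells nothing at effective values up to (t + p)/2, so every buyer above
`p` takes Alice's lottery with certainty and she earns Γ(p)/2. Letting the price increase to the
smallest solution of Γ(p) = Γ(v)/2 yields Γ(v)/4. -/

theorem measure_eq_zero (hf : IsDensity D f) {s : Set ℝ} (hs : volume s = 0) : D s = 0 := by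
  obtain ⟨-, -, hD⟩ := hf
  rw [hD]
  exact withDensity_absolutelyContinuous _ _ hs

theorem nullSingletonClass (hf : IsDensity D f) : NullSingletonClass D :=
  ⟨fun _ => hf.measure_eq_zero (measure_singleton _)⟩

variable [IsProbabilityMeasure D]

theorem integrable (hf : IsDensity D f) : Integrable f := by
  obtain ⟨hm, h0, hD⟩ := hf
  refine ⟨hm.aestronglyMeasurable, ?_⟩
  rw [hasFiniteIntegral_iff_ofReal (Eventually.of_forall h0)]
  have h : D univ = ∫⁻ v, ENNReal.ofReal (f v) := by
    rw [hD, withDensity_apply _ MeasurableSet.univ, setLIntegral_univ]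
  rw [← h]
  exact measure_lt_top D univ

theorem cdf_sub_cdf (hf : IsDensity D f) {a b : ℝ} (hab : a ≤ b) :
    cdf D b - cdf D a = ∫ t in a..b, f t := by
  have h1 : D (Ioc a b) = ENNReal.ofReal (cdf D b - cdf D a) := by
    conv_lhs => rw [← measure_cdf D]
    exact StieltjesFunction.measure_Ioc _ _ _
  have h2 : D (Ioc a b) = ENNReal.ofReal (∫ t in a..b, f t) := by
    obtain ⟨hm, h0, hD⟩ := id hf
    rw [intervalIntegral.integral_of_le hab,
      ofReal_integral_eq_lintegral_ofReal hf.integrable.integrableOn (Eventually.of_forall h0),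
      hD, withDensity_apply _ measurableSet_Ioc]
  have h3 : 0 ≤ ∫ t in a..b, f t :=
    intervalIntegral.integral_nonneg hab (fun t _ => hf.2.1 t)
  exact (ENNReal.ofReal_eq_ofReal_iff (sub_nonneg.2 (monotone_cdf D hab)) h3).1 (h1.symm.trans h2)

theorem cdf_eq (hf : IsDensity D f) (a x : ℝ) :
    cdf D x = cdf D a + ∫ t in a..x, f t := by
  rcases le_total a x with h | h
  · rw [← hf.cdf_sub_cdf h]; ring
  · rw [intervalIntegral.integral_symm, ← hf.cdf_sub_cdf h]; ring

theorem continuous_cdf (hf : IsDensity D f) : Continuous (cdf D) := by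
  have h : (cdf D : ℝ → ℝ) = fun x => cdf D 0 + ∫ t in (0 : ℝ)..x, f t :=
    funext fun x => hf.cdf_eq 0 x
  rw [h]
  exact continuous_const.add
    (intervalIntegral.continuous_primitive (fun _ _ => hf.integrable.intervalIntegrable) 0)

theorem continuous_revenueCurve (hf : IsDensity D f) : Continuous (revenueCurve D) :=
  continuous_id.mul (continuous_const.sub hf.continuous_cdf)

theorem measure_Ici (hf : IsDensity D f) (s : ℝ) : D (Ici s) = ENNReal.ofReal (1 - cdf D s) := by
  have := hf.nullSingletonClass
  rw [← measure_congr (Ioi_ae_eq_Ici (μ := D) (a := s)), ← compl_Iic,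
    measure_compl measurableSet_Iic (measure_ne_top _ _), measure_univ, ← ofReal_cdf,
    ENNReal.ofReal_sub _ (cdf_nonneg _ _), ENNReal.ofReal_one]

theorem measure_Ioi (hf : IsDensity D f) (s : ℝ) : D (Ioi s) = ENNReal.ofReal (1 - cdf D s) := by
  have := hf.nullSingletonClass
  rw [measure_congr (Ioi_ae_eq_Ici (μ := D) (a := s)), hf.measure_Ici]

theorem measure_Ico (hf : IsDensity D f) (a b : ℝ) :
    D (Ico a b) = ENNReal.ofReal (cdf D b - cdf D a) := by
  have := hf.nullSingletonClass
  rw [measure_congr (Ico_ae_eq_Ioc (μ := D) (a := a) (b := b))]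
  conv_lhs => rw [← measure_cdf D]
  exact StieltjesFunction.measure_Ioc _ _ _

/-- Integration by parts for absolutely continuous functions: the density need not be continuous, so
the revenue curve has the expected derivative only almost everywhere. -/
theorem revenueCurve_sub (hf : IsDensity D f) (a b : ℝ) :
    revenueCurve D b - revenueCurve D a = ∫ t in a..b, ((1 - cdf D t) - t * f t) := by
  have hac : AbsolutelyContinuousOnInterval (fun x => ∫ t in a..x, f t) a b :=
    (hf.integrable.intervalIntegrable (a := a)
      (b := b)).absolutelyContinuousOnInterval_intervalIntegral (by simp)
  have hcdf : AbsolutelyContinuousOnInterval (fun x => 1 - cdf D x) a b := by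
    have h : (fun x => 1 - cdf D x) = fun x => (1 - cdf D a) - ∫ t in a..x, f t := by
      funext x; rw [hf.cdf_eq a x]; ring
    rw [h]
    refine AbsolutelyContinuousOnInterval.sub (f := fun _ => 1 - cdf D a) ?_ hac
    exact (LipschitzWith.const (1 - cdf D a)).lipschitzOnWith.absolutelyContinuousOnInterval
  have hid : AbsolutelyContinuousOnInterval (fun x : ℝ => x) a b :=
    LipschitzWith.id.lipschitzOnWith.absolutelyContinuousOnInterval
  have key := hid.integral_deriv_mul_eq_sub hcdf
  rw [revenueCurve, revenueCurve, ← key]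
  refine intervalIntegral.integral_congr_ae ?_
  filter_upwards [LocallyIntegrable.ae_hasDerivAt_integral hf.integrable.locallyIntegrable] with x hx _
  have h1 : HasDerivAt (fun x => 1 - cdf D x) (-f x) x := by
    have h : (fun x => 1 - cdf D x) = fun x => (1 - cdf D a) - ∫ t in a..x, f t := by
      funext x; rw [hf.cdf_eq a x]; ring
    rw [h]
    exact (hx a).const_sub _
  rw [h1.deriv]
  simp
  ring

theorem intervalIntegrable_marginal (hf : IsDensity D f) (a b : ℝ) :
    IntervalIntegrable (fun t => (1 - cdf D t) - t * f t) volume a b :=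
  ((continuous_const.sub hf.continuous_cdf).intervalIntegrable a b).sub
    ((hf.integrable.intervalIntegrable).continuousOn_mul continuous_id.continuousOn)

/-- Some price yields positive revenue. -/
theorem exists_revenueCurve_pos (hf : IsDensity D f) (hD : D (Iio 0) = 0) :
    ∃ z : ℝ≥0, 0 < revenueCurve D z := by
  by_contra! h
  have h1 : ∀ x : ℝ, 0 < x → cdf D x = 1 := by
    intro x hx
    have h2 := h ⟨x, hx.le⟩
    simp only [revenueCurve] at h2
    have h3 := cdf_le_one D x
    have h4 : 1 - cdf D x ≤ 0 := nonpos_of_mul_nonpos_right h2 hx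
    linarith
  have h0 : cdf D 0 = 0 := by
    have := hf.nullSingletonClass
    rw [cdf_eq_real, measureReal_def, ← measure_congr (Iio_ae_eq_Iic (μ := D) (a := (0 : ℝ))), hD]
    rfl
  have h5 : Tendsto (cdf D) (𝓝[>] 0) (𝓝 (cdf D 0)) :=
    (hf.continuous_cdf.tendsto 0).mono_left nhdsWithin_le_nhds
  have h6 : Tendsto (cdf D) (𝓝[>] 0) (𝓝 1) :=
    tendsto_const_nhds.congr' (by
      filter_upwards [self_mem_nhdsWithin] with x hx using (h1 x hx).symm)
  have h7 := tendsto_nhds_unique h5 h6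
  rw [h0] at h7
  exact zero_ne_one h7

/-- Below a Myerson price, the marginal revenue `1 - F(t) - t f(t)` is non-increasing. -/
theorem antitoneOn_marginal (hf : IsDensity D f) (hreg : IsRegularDist D f ∨ IsDMRDist D f)
    {v : ℝ} (hv : ∀ z, 0 ≤ z → revenueCurve D z ≤ revenueCurve D v) (hv1 : cdf D v < 1) :
    AntitoneOn (fun t => (1 - cdf D t) - t * f t) (Ico 0 v) := by
  have hr : ∀ t ∈ Icc 0 v, t ∈ valueRange D := fun t ht =>
    ⟨ht.1, (monotone_cdf D ht.2).trans_lt hv1⟩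
  rcases hreg with hreg | hreg
  -- A positive virtual value at w < v would stay positive up to `v`, so the revenue curve would
  -- strictly decrease from w to `v`, against the maximality of `v`.
  · have hφ : ∀ t ∈ Ico 0 v, virtualValue D f t ≤ 0 := by
      intro w hw
      by_contra! hpos
      have hneg : ∀ u ∈ Icc w v, (1 - cdf D u) - u * f u < 0 := by
        intro u hu
        have h1 := hpos.trans_le (hreg (hr w ⟨hw.1, hw.2.le⟩)
          (hr u ⟨hw.1.trans hu.1, hu.2⟩) hu.1)
        rw [virtualValue] at h1
        split_ifs at h1 with h2
        · simp at h1
        · have h3 : 0 < f u := lt_of_le_of_ne (hf.2.1 u) (Ne.symm h2)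
          have h4 : 0 < u - (1 - cdf D u) / f u := by exact_mod_cast h1
          have h5 : (1 - cdf D u) / f u < u := by linarith
          rw [div_lt_iff₀ h3] at h5
          linarith
      have h6 : 0 < ∫ t in w..v, -((1 - cdf D t) - t * f t) :=
        intervalIntegral.intervalIntegral_pos_of_pos_on
          (hf.intervalIntegrable_marginal w v).neg
          (fun u hu => by linarith [hneg u ⟨hu.1.le, hu.2.le⟩]) hw.2
      rw [intervalIntegral.integral_neg, ← hf.revenueCurve_sub] at h6
      linarith [hv w hw.1]
    intro a ha b hb hab
    simp only
    have hFab := monotone_cdf D hab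
    have hFb : cdf D b < 1 := (hr b ⟨hb.1, hb.2.le⟩).2
    have hm := hreg (hr a ⟨ha.1, ha.2.le⟩) (hr b ⟨hb.1, hb.2.le⟩) hab
    have hbφ := hφ b hb
    by_cases h1 : f a = 0
    · rw [h1]
      linarith [mul_nonneg hb.1 (hf.2.1 b)]
    by_cases h2 : f b = 0
    · rw [virtualValue, virtualValue, if_neg h1, if_pos h2, le_bot_iff] at hm
      exact absurd hm (EReal.coe_ne_bot _)
    · rw [virtualValue, if_neg h2] at hbφ
      rw [virtualValue, virtualValue, if_neg h1, if_neg h2] at hm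
      have fa : 0 < f a := lt_of_le_of_ne (hf.2.1 a) (Ne.symm h1)
      have fb : 0 < f b := lt_of_le_of_ne (hf.2.1 b) (Ne.symm h2)
      have hm' : a - (1 - cdf D a) / f a ≤ b - (1 - cdf D b) / f b := by exact_mod_cast hm
      have hb' : b - (1 - cdf D b) / f b ≤ 0 := by exact_mod_cast hbφ
      -- With q = (1 - F)/f, the marginal revenue is (1 - F)(q - t)/q. Both factors are nonnegative
      -- and non-increasing; for the second, q - t is minus the virtual value.
      set qa := (1 - cdf D a) / f a with hqa
      set qb := (1 - cdf D b) / f b with hqb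
      have hqa0 : 0 < qa := div_pos (by linarith) fa
      have hqb0 : 0 < qb := div_pos (by linarith) fb
      have ea : (1 - cdf D a) - a * f a = (1 - cdf D a) * ((qa - a) / qa) := by
        rw [hqa]; have : 1 - cdf D a ≠ 0 := by linarith
        field_simp
      have eb : (1 - cdf D b) - b * f b = (1 - cdf D b) * ((qb - b) / qb) := by
        rw [hqb]; have : 1 - cdf D b ≠ 0 := by linarith
        field_simp
      rw [ea, eb]
      refine mul_le_mul (by linarith) ?_ (div_nonneg (by linarith) hqb0.le) (by linarith)
      rw [div_le_div_iff₀ hqb0 hqa0]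
      nlinarith [mul_nonneg ha.1 (sub_nonneg.2 hb'), mul_nonneg hb.1 (sub_nonneg.2 hm'),
        ha.1, hb.1, mul_nonneg ha.1 hb.1]
  · intro a ha b hb hab
    have := hreg (hr a ⟨ha.1, ha.2.le⟩) (hr b ⟨hb.1, hb.2.le⟩) hab
    simp only at this ⊢
    linarith

/-- Below a Myerson price, the revenue curve has a non-negative supergradient. -/
theorem exists_supergradient (hf : IsDensity D f) (hreg : IsRegularDist D f ∨ IsDMRDist D f)
    {v : ℝ} (hv : ∀ z, 0 ≤ z → revenueCurve D z ≤ revenueCurve D v) (hv1 : cdf D v < 1)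
    {p : ℝ} (hp0 : 0 ≤ p) (hpv : p < v) :
    ∃ m, 0 ≤ m ∧ ∀ q, 0 ≤ q → revenueCurve D q ≤ revenueCurve D p + m * (q - p) := by
  have hanti := hf.antitoneOn_marginal hreg hv hv1
  set γ : ℝ → ℝ := fun t => (1 - cdf D t) - t * f t with hγ
  have hup : ∀ q, p ≤ q → q ≤ v → revenueCurve D q ≤ revenueCurve D p + γ p * (q - p) := by
    intro q h1 h2
    have h3 : ∫ t in p..q, γ t ≤ ∫ t in p..q, γ p := by
      refine intervalIntegral.integral_mono_on_of_le_Ioo h1 (hf.intervalIntegrable_marginal p q)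
        (by simp) ?_
      intro t ht
      exact hanti ⟨hp0, hpv⟩ ⟨hp0.trans ht.1.le, ht.2.trans_le h2⟩ ht.1.le
    rw [← hf.revenueCurve_sub, intervalIntegral.integral_const, smul_eq_mul] at h3
    linarith
  have hm : 0 ≤ γ p := by
    have h1 := hup v hpv.le le_rfl
    have h2 := hv p hp0
    by_contra! h3
    nlinarith [mul_pos (neg_pos.2 h3) (sub_pos.2 hpv)]
  refine ⟨γ p, hm, fun q hq => ?_⟩
  rcases le_total q p with h | h
  · have h3 : ∫ t in q..p, γ p ≤ ∫ t in q..p, γ t := by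
      refine intervalIntegral.integral_mono_on h (by simp) (hf.intervalIntegrable_marginal q p) ?_
      intro t ht
      exact hanti ⟨hq.trans ht.1, ht.2.trans_lt hpv⟩ ⟨hp0, hpv⟩ ht.2
    rw [← hf.revenueCurve_sub, intervalIntegral.integral_const, smul_eq_mul] at h3
    linarith
  · rcases le_total q v with h' | h'
    · exact hup q h h'
    -- Beyond `v` the marginal revenue is not controlled, but there the curve is below its value at
    -- `v` and the line through `p` has nonnegative slope.
    · have h1 := hup v hpv.le le_rfl
      have h2 := hv q hq
      have h3 := mul_le_mul_of_nonneg_left (sub_le_sub_right h' p) hm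
      linarith

end IsDensity

/-! ### Convex indirect utilities as mixtures of posted prices -/

section Subgradient

variable {x U : ℝ → ℝ}

theorem monotone_of_subgradient (h : ∀ w w', U w + x w * (w' - w) ≤ U w') : Monotone x := by
  intro a b hab
  rcases hab.eq_or_lt with rfl | hlt
  · exact le_rfl
  · have h1 := h a b
    have h2 := h b a
    by_contra! h3
    nlinarith [mul_pos (sub_pos.2 h3) (sub_pos.2 hlt)]

theorem lipschitzWith_of_subgradient (h : ∀ w w', U w + x w * (w' - w) ≤ U w')
    (hx : ∀ w, x w ∈ Icc (0 : ℝ) 1) : LipschitzWith 1 U := by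
  refine LipschitzWith.of_le_add fun a b => ?_
  have h1 := h a b
  have h2 : x a * (a - b) ≤ |a - b| := by
    calc x a * (a - b) ≤ x a * |a - b| := mul_le_mul_of_nonneg_left (le_abs_self _) (hx a).1
      _ ≤ 1 * |a - b| := mul_le_mul_of_nonneg_right (hx a).2 (abs_nonneg _)
      _ = |a - b| := one_mul _
  rw [Real.dist_eq]
  linarith

theorem hasDerivAt_of_subgradient (h : ∀ w w', U w + x w * (w' - w) ≤ U w') {w : ℝ}
    (hw : ContinuousAt x w) : HasDerivAt U (x w) w := by
  rw [hasDerivAt_iff_isLittleO, Asymptotics.isLittleO_iff]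
  intro c hc
  have h1 := Metric.continuousAt_iff'.1 hw c hc
  filter_upwards [h1] with y hy
  rw [Real.dist_eq] at hy
  have h2 := h w y
  have h3 := h y w
  rw [smul_eq_mul, Real.norm_eq_abs, Real.norm_eq_abs]
  have h4 : U y - U w - (y - w) * x w ≤ (x y - x w) * (y - w) := by linarith
  have h5 : (x y - x w) * (y - w) ≤ c * |y - w| := by
    calc (x y - x w) * (y - w) ≤ |(x y - x w) * (y - w)| := le_abs_self _
      _ = |x y - x w| * |y - w| := abs_mul _ _
      _ ≤ c * |y - w| := mul_le_mul_of_nonneg_right hy.le (abs_nonneg _)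
  rw [abs_of_nonneg (by linarith)]
  linarith

/-- A monotone selection of subgradients has countably many discontinuities and is the derivative of
`U` at all other points. -/
theorem integral_of_subgradient (h : ∀ w w', U w + x w * (w' - w) ≤ U w')
    (hx : ∀ w, x w ∈ Icc (0 : ℝ) 1) (a b : ℝ) : ∫ t in a..b, x t = U b - U a :=
  integral_eq_of_hasDerivAt_off_countable U x
    (monotone_of_subgradient h).countable_not_continuousAt
    (lipschitzWith_of_subgradient h hx).continuous.continuousOn
    (fun _ ht => hasDerivAt_of_subgradient h (not_not.1 ht.2))
    (monotone_of_subgradient h).intervalIntegrable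

/-- A convex function on the line that vanishes on the negative half-line and has slopes in
`[0, 1]` is a mixture of the functions `w ↦ (w - s)⁺`. -/
theorem exists_measure_of_subgradient (h : ∀ w w', U w + x w * (w' - w) ≤ U w')
    (hx : ∀ w, x w ∈ Icc (0 : ℝ) 1) (hx0 : ∀ w < 0, x w = 0) (hU0 : U 0 = 0) :
    ∃ ν : Measure ℝ, ν univ ≤ 1 ∧ ν (Iio 0) = 0 ∧
      (∀ w, 0 ≤ w → U w = ∫ s, max (w - s) 0 ∂ν) ∧ ∀ w, ENNReal.ofReal (x w) ≤ ν (Iic w) := by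
  have hmono := monotone_of_subgradient h
  -- The measure is the Stieltjes measure of the right-continuous version of the slope. A positive
  -- slope at 0 gives an atom there.
  set g := hmono.stieltjesFunction with hg
  have hgx : ∀ w, x w ≤ g w := fun w => by
    rw [hg, hmono.stieltjesFunction_eq]; exact hmono.le_rightLim le_rfl
  have hgle : ∀ {w y}, w < y → g w ≤ x y := fun {w y} hwy => by
    rw [hg, hmono.stieltjesFunction_eq]; exact hmono.rightLim_le hwy
  have hg0 : ∀ w < 0, g w = 0 := fun w hw => by
    refine le_antisymm ?_ ((hx w).1.trans (hgx w))
    have := hgle (show w < w / 2 by linarith)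
    rwa [hx0 (w / 2) (by linarith)] at this
  have hg1 : ∀ w, g w ≤ 1 := fun w => (hgle (lt_add_one w)).trans (hx _).2
  have hbot : Tendsto g atBot (𝓝 0) := by
    refine tendsto_const_nhds.congr' ?_
    filter_upwards [eventually_lt_atBot 0] with w hw using (hg0 w hw).symm
  have hIic : ∀ w, g.measure (Iic w) = ENNReal.ofReal (g w) := fun w => by
    rw [g.measure_Iic hbot, sub_zero]
  have huniv : g.measure univ ≤ 1 := by
    have hun : (univ : Set ℝ) = ⋃ n : ℕ, Iic (n : ℝ) := by
      refine (eq_univ_of_forall fun s => mem_iUnion.2 ?_).symm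
      exact exists_nat_ge s
    have hd : Directed (· ⊆ ·) (fun n : ℕ => Iic (n : ℝ)) :=
      Monotone.directed_le fun a b hab => Iic_subset_Iic.2 (Nat.cast_le.2 hab)
    rw [hun]
    rw [hd.measure_iUnion]
    refine iSup_le fun w => ?_
    rw [hIic]
    exact ENNReal.ofReal_le_one.2 (hg1 w)
  have hfin : IsFiniteMeasure g.measure := ⟨huniv.trans_lt ENNReal.one_lt_top⟩
  have hneg : g.measure (Iio 0) = 0 := by
    have : Iio (0 : ℝ) = ⋃ n : ℕ, Iic (-(1 / ((n : ℝ) + 1))) := by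
      ext s
      simp only [mem_Iio, mem_iUnion, mem_Iic]
      constructor
      · intro hs
        obtain ⟨n, hn⟩ := exists_nat_one_div_lt (neg_pos.2 hs)
        exact ⟨n, by linarith⟩
      · rintro ⟨n, hn⟩
        have : 0 < 1 / ((n : ℝ) + 1) := by positivity
        linarith
    rw [this, measure_iUnion_null_iff]
    intro n
    rw [hIic, hg0 _ (by have : 0 < 1 / ((n : ℝ) + 1) := by positivity
                        linarith), ENNReal.ofReal_zero]
  refine ⟨g.measure, huniv, hneg, fun w hw => ?_, fun w => ?_⟩
  · have hint : Integrable (fun s => max (w - s) 0) g.measure := by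
      refine Integrable.of_bound (C := w) (by fun_prop) ?_
      have : ∀ᵐ s ∂g.measure, s ∉ Iio 0 := measure_eq_zero_iff_ae_notMem.1 hneg
      filter_upwards [this] with s hs
      rw [Real.norm_eq_abs, abs_of_nonneg (le_max_right _ _)]
      exact max_le (by linarith [not_lt.1 (mem_Iio.not.1 hs)]) hw
    rw [hint.integral_eq_integral_meas_le (Eventually.of_forall fun s => le_max_right _ _)]
    -- Layer-cake formula: the level sets of (w - s)⁺ are half-lines of measure `g (w - t)`, which
    -- equals `x (w - t)` except at countably many t.
    have h1 : ∫ t in Ioi 0, g.measure.real {s | t ≤ max (w - s) 0}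
        = ∫ t in Ioi (0 : ℝ), x (w - t) := by
      refine setIntegral_congr_ae measurableSet_Ioi ?_
      have hc : {t : ℝ | ¬ ContinuousAt x (w - t)}.Countable := by
        have := hmono.countable_not_continuousAt
        exact this.preimage (f := fun t => w - t) (sub_right_injective (b := w))
      filter_upwards [hc.ae_notMem volume] with t ht hpos
      have hpos : 0 < t := hpos
      have hset : {s | t ≤ max (w - s) 0} = Iic (w - t) := by
        ext s
        simp only [mem_ofPred_eq, le_max_iff, mem_Iic]
        constructor
        · rintro (h | h) <;> linarith
        · intro h; left; linarith
      have hcont : ContinuousAt x (w - t) := not_not.1 ht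
      rw [hset, measureReal_def, hIic, ENNReal.toReal_ofReal ((hx _).1.trans (hgx _)), hg,
        hmono.stieltjesFunction_eq]
      exact (hmono.continuousWithinAt_Ioi_iff_rightLim_eq).1 hcont.continuousWithinAt
    rw [h1]
    have h2 : ∫ t in Ioi (0 : ℝ), x (w - t) = ∫ t in Ioc 0 w, x (w - t) := by
      refine setIntegral_eq_of_subset_of_forall_sdiff_eq_zero measurableSet_Ioi
        Ioc_subset_Ioi_self ?_
      rintro t ⟨ht, ht'⟩
      refine hx0 _ ?_
      by_contra! hh
      exact ht' ⟨ht, by linarith⟩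
    rw [h2, ← intervalIntegral.integral_of_le hw, intervalIntegral.integral_comp_sub_left,
      integral_of_subgradient h hx]
    simp [hU0]
  · rw [hIic]
    exact ENNReal.ofReal_le_ofReal (hgx w)

end Subgradient

/-! ### Monopoly choices -/

/-- The utility of a buyer of value `w` who takes the option `x w` of `M`. -/
noncomputable def indirectUtility (M : Mechanism) (x : ℝ → ℝ) (w : ℝ) : ℝ :=
  w * x w - (M.price (x w)).toReal

/-- `x` selects a utility-maximizing option of `M` for every non-negative value. -/
def IsMonopolySelection (M : Mechanism) (x : ℝ → ℝ) : Prop :=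
  ∀ v, 0 ≤ v → IsMonopolyChoice M v (x v)

/-- `ν` is the distribution of the marginal prices of `M`, along the selection `x`: facing `M` is
like facing the posted price `s` with probability `ν (ds)`. -/
structure IsMarginalPriceLaw (M : Mechanism) (x : ℝ → ℝ) (ν : Measure ℝ) : Prop where
  univ_le : ν univ ≤ 1
  Iio_zero : ν (Iio 0) = 0
  utility_eq : ∀ w, 0 ≤ w → indirectUtility M x w = ∫ s, max (w - s) 0 ∂ν
  le_Iic : ∀ w, 0 ≤ w → ENNReal.ofReal (x w) ≤ ν (Iic w)
  price_le : ∀ w, 0 ≤ w → M.price (x w) ≤ ∫⁻ s in Iic w, ENNReal.ofReal s ∂ν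

namespace IsMarginalPriceLaw

variable {M : Mechanism} {x : ℝ → ℝ} {ν : Measure ℝ}

theorem isFiniteMeasure (h : IsMarginalPriceLaw M x ν) : IsFiniteMeasure ν :=
  ⟨h.univ_le.trans_lt ENNReal.one_lt_top⟩

theorem ae_nonneg (h : IsMarginalPriceLaw M x ν) : ∀ᵐ s ∂ν, 0 ≤ s := by
  filter_upwards [measure_eq_zero_iff_ae_notMem.1 h.Iio_zero] with s hs using not_lt.1 hs

end IsMarginalPriceLaw

namespace IsMonopolySelection

variable {M : Mechanism} {x : ℝ → ℝ}

theorem le_indirectUtility (h : IsMonopolySelection M x) {w y : ℝ} (hw : 0 ≤ w)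
    (hy : y ∈ Icc (0 : ℝ) 1) (hM : M.price y ≠ ⊤) :
    w * y - (M.price y).toReal ≤ indirectUtility M x w :=
  (h w hw).2.2 y hy hM

theorem subgradient (h : IsMonopolySelection M x) {w w' : ℝ} (hw : 0 ≤ w) (hw' : 0 ≤ w') :
    indirectUtility M x w + x w * (w' - w) ≤ indirectUtility M x w' := by
  have := h.le_indirectUtility hw' (h w hw).1 (h w hw).2.1
  rw [indirectUtility]
  linarith

theorem indirectUtility_nonneg (h : IsMonopolySelection M x) {w : ℝ} (hw : 0 ≤ w) :
    0 ≤ indirectUtility M x w := by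
  have := h.le_indirectUtility (y := 0) hw (by simp) (by simp [M.price_zero])
  simpa [M.price_zero] using this

theorem indirectUtility_zero (h : IsMonopolySelection M x) : indirectUtility M x 0 = 0 := by
  refine le_antisymm ?_ (h.indirectUtility_nonneg le_rfl)
  rw [indirectUtility]
  simp

/-- The extension of the selection by zero to negative values, and of the indirect utility. -/
theorem subgradient_extend (h : IsMonopolySelection M x) (w w' : ℝ) :
    indirectUtility M x (max w 0) + (if w < 0 then 0 else x w) * (w' - w)
      ≤ indirectUtility M x (max w' 0) := by
  split_ifs with hw
  · rw [max_eq_right hw.le, h.indirectUtility_zero]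
    simpa using h.indirectUtility_nonneg (le_max_right w' 0)
  · have hw := not_lt.1 hw
    rw [max_eq_left hw]
    refine le_trans ?_ (h.subgradient hw (le_max_right w' 0))
    have := mul_le_mul_of_nonneg_left (sub_le_sub_right (le_max_left w' 0) w) (h w hw).1.1
    linarith

theorem extend_mem (h : IsMonopolySelection M x) (w : ℝ) :
    (if w < 0 then 0 else x w) ∈ Icc (0 : ℝ) 1 := by
  split_ifs with hw
  · simp
  · exact (h w (not_lt.1 hw)).1

theorem monotoneOn (h : IsMonopolySelection M x) : MonotoneOn x (Ici 0) := by
  intro a ha b hb hab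
  have := monotone_of_subgradient h.subgradient_extend hab
  rwa [if_neg (not_lt.2 ha), if_neg (not_lt.2 hb)] at this

theorem lipschitz (h : IsMonopolySelection M x) :
    LipschitzWith 1 (fun w => indirectUtility M x (max w 0)) :=
  lipschitzWith_of_subgradient h.subgradient_extend h.extend_mem

theorem ofReal_price (h : IsMonopolySelection M x) {w : ℝ} (hw : 0 ≤ w) :
    M.price (x w) = ENNReal.ofReal (w * x w - indirectUtility M x w) := by
  rw [indirectUtility, sub_sub_cancel, ENNReal.ofReal_toReal (h w hw).2.1]

/-- Equality may fail in the last two bounds: at a kink of the indirect utility, `x w` can be any of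
several optimal options, while ν (Iic w) is the right limit of the slope. The payment w · x(w) -
U(w) increases with the option, hence the inequality for prices. -/
theorem exists_isMarginalPriceLaw (h : IsMonopolySelection M x) :
    ∃ ν : Measure ℝ, IsMarginalPriceLaw M x ν := by
  obtain ⟨ν, h1, h2, h3, h4⟩ := exists_measure_of_subgradient h.subgradient_extend h.extend_mem
    (fun w hw => if_pos hw) (by simp [h.indirectUtility_zero])
  have h3' : ∀ w, 0 ≤ w → indirectUtility M x w = ∫ s, max (w - s) 0 ∂ν := fun w hw => by
    rw [← h3 w hw, max_eq_left hw]
  have h4' : ∀ w, 0 ≤ w → ENNReal.ofReal (x w) ≤ ν (Iic w) := fun w hw => by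
    have := h4 w
    rwa [if_neg (not_lt.2 hw)] at this
  have hfin : IsFiniteMeasure ν := ⟨h1.trans_lt ENNReal.one_lt_top⟩
  refine ⟨ν, h1, h2, h3', h4', fun w hw => ?_⟩
  have hae : ∀ᵐ s ∂ν, 0 ≤ s := by
    filter_upwards [measure_eq_zero_iff_ae_notMem.1 h2] with s hs using not_lt.1 hs
  have hbd : ∀ᵐ s ∂ν.restrict (Iic w), ‖s‖ ≤ w := by
    filter_upwards [ae_restrict_of_ae hae, ae_restrict_mem measurableSet_Iic] with s hs hs'
    rw [Real.norm_eq_abs, abs_of_nonneg hs]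
    exact hs'
  have hid : IntegrableOn (fun s : ℝ => s) (Iic w) ν :=
    Integrable.of_bound (C := w) (by fun_prop) hbd
  rw [h.ofReal_price hw, ← ofReal_integral_eq_lintegral_ofReal hid (ae_restrict_of_ae hae)]
  refine ENNReal.ofReal_le_ofReal ?_
  have e1 : indirectUtility M x w = w * ν.real (Iic w) - ∫ s in Iic w, s ∂ν := by
    rw [h3' w hw]
    have : ∫ s, max (w - s) 0 ∂ν = ∫ s in Iic w, (w - s) ∂ν := by
      rw [← integral_indicator measurableSet_Iic]
      refine integral_congr_ae (Eventually.of_forall fun s => ?_)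
      by_cases hs : s ≤ w
      · simp [indicator, hs]
      · simp [indicator, hs, (not_le.1 hs).le]
    rw [this, integral_sub (integrable_const _) hid, setIntegral_const, smul_eq_mul, mul_comm]
  have e2 : x w ≤ ν.real (Iic w) := by
    rw [measureReal_def]
    exact (ENNReal.ofReal_le_iff_le_toReal (measure_ne_top _ _)).1 (h4' w hw)
  have := mul_le_mul_of_nonneg_left e2 hw
  linarith

end IsMonopolySelection

/-! ### Lotteries -/

theorem lottery_price_ne_top {p : ℝ≥0} {z : ℝ} (hz : z ∈ Icc (0 : ℝ) 1) {a : ℝ} :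
    (lottery p z hz).price a ≠ ⊤ ↔ a ≤ z := by
  change lotteryPrice p z a ≠ ⊤ ↔ _
  rw [lotteryPrice]
  split_ifs with h
  · simp [h, ENNReal.mul_eq_top]
  · simp [h]

theorem lottery_price_toReal {p : ℝ≥0} {z : ℝ} (hz : z ∈ Icc (0 : ℝ) 1) {a : ℝ} (ha : 0 ≤ a)
    (haz : a ≤ z) : ((lottery p z hz).price a).toReal = p * a := by
  change (lotteryPrice p z a).toReal = _
  rw [lotteryPrice, if_pos haz, ENNReal.toReal_mul, ENNReal.toReal_ofReal ha]
  rfl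

/-! ### The buyer facing a lottery of Alice -/

theorem IsMonopolySelection.choice_of_le {B : Mechanism} {x : ℝ → ℝ}
    (h : IsMonopolySelection B x) {w y : ℝ} (hw : 0 ≤ w) (hy : y ∈ Icc (0 : ℝ) 1)
    (hB : B.price y ≠ ⊤) (hle : indirectUtility B x w ≤ w * y - (B.price y).toReal) :
    IsMonopolyChoice B w y :=
  ⟨hy, hB, fun _ h1 h2 => (h.le_indirectUtility hw h1 h2).trans hle⟩

/-- `x` selects the largest utility-maximizing option of `B` for every non-negative value. -/
def IsGreatestSelection (B : Mechanism) (x : ℝ → ℝ) : Prop :=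
  IsMonopolySelection B x ∧ ∀ w, 0 ≤ w → ∀ y, IsMonopolyChoice B w y → y ≤ x w

/-- Attainment of the maximum is read off from the buyer rule: against an Alice who offers nothing,
the buyer is a monopoly buyer of `B`, and tie-breaking in favor of Bob picks the largest option. -/
theorem BuyerRule.IsOptimal.exists_greatestSelection {σ : BuyerRule} (hσ : σ.IsOptimal)
    (B : Mechanism) : ∃ x, IsGreatestSelection B x := by
  set A := lottery 0 0 (by simp) with hA
  have hA0 : A.price 0 ≠ ⊤ := (lottery_price_ne_top (by simp)).2 le_rfl
  have hA0' : (A.price 0).toReal = 0 := by simp [A.price_zero]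
  have hutil : ∀ (w : ℝ) (s : BuyerPlan), s.a = 0 →
      s.utility A B w = w * s.b - (B.price s.b).toReal ∧ s.allocB = s.b ∧ s.allocA = 0 := by
    rintro w ⟨bf, a, b⟩ rfl
    cases bf <;> simp [BuyerPlan.utility, BuyerPlan.allocA, BuyerPlan.allocB, BuyerPlan.payA,
      BuyerPlan.payB, BuyerPlan.reachA, BuyerPlan.reachB, hA0']
  have ha : ∀ w, 0 ≤ w → (σ A B w).a = 0 := fun w hw =>
    le_antisymm ((lottery_price_ne_top (by simp)).1 (hσ A B w hw).1.2.2.1) (hσ A B w hw).1.1.1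
  have hfeas : ∀ y ∈ Icc (0 : ℝ) 1, B.price y ≠ ⊤ → (BuyerPlan.mk true 0 y).Feasible A B :=
    fun y hy hB => ⟨by simp, hy, hA0, hB⟩
  have hsel : IsMonopolySelection B (fun w => (σ A B w).b) := by
    intro w hw
    have hopt := hσ A B w hw
    refine ⟨hopt.1.2.1, hopt.1.2.2.2, fun y hy hB => ?_⟩
    have h1 := hopt.2 _ (hfeas y hy hB)
    rw [(hutil w _ (ha w hw)).1, (hutil w ⟨true, 0, y⟩ rfl).1] at h1
    rcases h1 with h1 | h1
    · exact h1.le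
    · exact h1.1.le
  refine ⟨_, hsel, fun w hw y hy => ?_⟩
  have h1 := (hσ A B w hw).2 _ (hfeas y hy.1 hy.2.1)
  rw [(hutil w _ (ha w hw)).1, (hutil w ⟨true, 0, y⟩ rfl).1, (hutil w _ (ha w hw)).2.1,
    (hutil w ⟨true, 0, y⟩ rfl).2.1] at h1
  have h2 := hy.2.2 _ (hsel w hw).1 (hsel w hw).2.1
  rcases h1 with h1 | ⟨-, h1 | h1⟩
  · exact absurd h1 (not_lt.2 h2)
  · exact h1.le
  · exact h1.1.le

theorem BuyerPlan.Optimal.utility_le {A B : Mechanism} {v : ℝ} {s t : BuyerPlan}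
    (h : s.Optimal A B v) (ht : t.Feasible A B) : t.utility A B v ≤ s.utility A B v := by
  rcases h.2 t ht with h1 | h1
  · exact h1.le
  · exact h1.1.le

section HalfLottery

variable {p : ℝ≥0} {hz : (1 / 2 : ℝ) ∈ Icc (0 : ℝ) 1} {B : Mechanism} {x : ℝ → ℝ} {v : ℝ}
  {s : BuyerPlan}

theorem utility_bobFirst {a b : ℝ} (ha : 0 ≤ a) (ha' : a ≤ 1 / 2) :
    (BuyerPlan.mk true a b).utility (lottery p (1 / 2) hz) B v
      = v * b - (B.price b).toReal + (1 - b) * (a * (v - p)) := by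
  simp only [BuyerPlan.utility, BuyerPlan.allocA, BuyerPlan.allocB, BuyerPlan.payA,
      BuyerPlan.payB, BuyerPlan.reachA, BuyerPlan.reachB, if_true, lottery_price_toReal hz ha ha']
  ring

theorem utility_aliceFirst {a b : ℝ} (ha : 0 ≤ a) (ha' : a ≤ 1 / 2) :
    (BuyerPlan.mk false a b).utility (lottery p (1 / 2) hz) B v
      = a * (v - p) + (1 - a) * (v * b - (B.price b).toReal) := by
  simp only [BuyerPlan.utility, BuyerPlan.allocA, BuyerPlan.allocB, BuyerPlan.payA,
      BuyerPlan.payB, BuyerPlan.reachA, BuyerPlan.reachB, Bool.false_eq_true, if_false,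
      lottery_price_toReal hz ha ha']
  ring

theorem feasible_half {bf : Bool} {a b : ℝ} (ha : 0 ≤ a) (ha' : a ≤ 1 / 2)
    (hb : b ∈ Icc (0 : ℝ) 1) (hB : B.price b ≠ ⊤) :
    (BuyerPlan.mk bf a b).Feasible (lottery p (1 / 2) hz) B :=
  ⟨⟨ha, by change a ≤ 1; linarith⟩, hb, (lottery_price_ne_top hz).2 ha', hB⟩

/-- A buyer whose value is below Alice's price buys only from Bob. -/
theorem payB_le_of_lt (hx : IsGreatestSelection B x) (hv : 0 ≤ v) (hvp : v < p)
    (hs : s.Optimal (lottery p (1 / 2) hz) B v) : s.payB B ≤ (B.price (x v)).toReal := by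
  obtain ⟨bf, a, b⟩ := s
  obtain ⟨⟨ha0, ha1⟩, hb, hA, hB⟩ := hs.1
  have ha2 : a ≤ 1 / 2 := (lottery_price_ne_top hz).1 hA
  have hxv := hx.1 v hv
  have h1 := hs.utility_le (feasible_half (bf := true) (a := 0) le_rfl (by norm_num) hxv.1 hxv.2.1)
  rw [utility_bobFirst le_rfl (by norm_num)] at h1
  have hU := hx.1.le_indirectUtility hv hb hB
  have hUdef : v * x v - (B.price (x v)).toReal = indirectUtility B x v := rfl
  have hU0 := hx.1.indirectUtility_nonneg hv
  simp only at ha0 ha1 hb hA hB hU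
  have hmono : ∀ y, IsMonopolyChoice B v y → (B.price y).toReal ≤ (B.price (x v)).toReal :=
    fun y hy => ENNReal.toReal_mono hxv.2.1 (B.monotoneOn hy.1 hxv.1 (hx.2 v hv y hy))
  have hch : indirectUtility B x v ≤ v * b - (B.price b).toReal → IsMonopolyChoice B v b :=
    hx.1.choice_of_le hv hb hB
  cases bf
  · rw [utility_aliceFirst ha0 ha2] at h1
    have h2 : (1 - a) * (v * b - (B.price b).toReal) ≤ (1 - a) * indirectUtility B x v :=
      mul_le_mul_of_nonneg_left hU (by linarith)
    have h3 : a = 0 := by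
      by_contra h
      have h4 : 0 < a := lt_of_le_of_ne ha0 (Ne.symm h)
      nlinarith [mul_pos h4 (sub_pos.2 hvp), mul_nonneg ha0 hU0]
    subst h3
    have := hmono b (hch (by linarith))
    simpa [BuyerPlan.payB, BuyerPlan.reachB] using this
  · rw [utility_bobFirst ha0 ha2] at h1
    have h2 : (1 - b) * (a * (v - p)) ≤ 0 :=
      mul_nonpos_of_nonneg_of_nonpos (by linarith [hb.2])
        (mul_nonpos_of_nonneg_of_nonpos ha0 (by linarith))
    have := hmono b (hch (by linarith))
    simpa [BuyerPlan.payB, BuyerPlan.reachB] using this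

/-- A buyer whose value exceeds Alice's price either visits Bob first, with the effective value
`(v + p) / 2`, or takes Alice's lottery first. -/
theorem optimal_of_gt (hx : IsMonopolySelection B x) (hvp : p < v)
    (hs : s.Optimal (lottery p (1 / 2) hz) B v) :
    (IsMonopolyChoice B ((v + p) / 2) s.b ∧
      indirectUtility B x v / 2 ≤ indirectUtility B x ((v + p) / 2) ∧
      s.payB B ≤ (B.price s.b).toReal ∧
      (s.b = 1 ∨ s.payA (lottery p (1 / 2) hz) = (1 - s.b) * (p / 2))) ∨
    (IsMonopolyChoice B v s.b ∧
      indirectUtility B x ((v + p) / 2) ≤ indirectUtility B x v / 2 ∧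
      s.payB B = (B.price s.b).toReal / 2 ∧ s.payA (lottery p (1 / 2) hz) = p / 2) := by
  obtain ⟨bf, a, b⟩ := s
  obtain ⟨⟨ha0, ha1⟩, hb, hA, hB⟩ := hs.1
  have ha2 : a ≤ 1 / 2 := (lottery_price_ne_top hz).1 hA
  simp only at ha0 ha1 hb hA hB ⊢
  have hp := p.2
  have hv : 0 ≤ v := hp.trans hvp.le
  have hw : 0 ≤ (v + p) / 2 := by positivity
  have half0 : (0 : ℝ) ≤ 1 / 2 := by norm_num
  have L1 := hs.utility_le
    (feasible_half (bf := true) half0 le_rfl (hx _ hw).1 (hx _ hw).2.1)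
  have L2 := hs.utility_le
    (feasible_half (bf := false) half0 le_rfl (hx _ hv).1 (hx _ hv).2.1)
  have L3 := hs.utility_le (feasible_half (bf := true) half0 le_rfl hb hB)
  have L4 := hs.utility_le (feasible_half (bf := false) half0 le_rfl hb hB)
  rw [utility_bobFirst half0 le_rfl] at L1 L3
  rw [utility_aliceFirst half0 le_rfl] at L2 L4
  have hUw : (v + p) / 2 * x ((v + p) / 2) - (B.price (x ((v + p) / 2))).toReal
    = indirectUtility B x ((v + p) / 2) := rfl
  have hUv : v * x v - (B.price (x v)).toReal = indirectUtility B x v := rfl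
  have hbw := hx.le_indirectUtility hw hb hB
  have hbv := hx.le_indirectUtility hv hb hB
  have hcw : indirectUtility B x ((v + p) / 2) ≤ (v + p) / 2 * b - (B.price b).toReal →
    IsMonopolyChoice B ((v + p) / 2) b := hx.choice_of_le hw hb hB
  have hcv : indirectUtility B x v ≤ v * b - (B.price b).toReal →
    IsMonopolyChoice B v b := hx.choice_of_le hv hb hB
  have hprice := ENNReal.toReal_nonneg (a := B.price b)
  cases bf
  · rw [utility_aliceFirst ha0 ha2] at L1 L2 L3 L4
    rcases ha2.eq_or_lt with rfl | halt
    · right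
      refine ⟨hcv (by linarith), by linarith, ?_, ?_⟩
      · simp only [BuyerPlan.payB, BuyerPlan.reachB, Bool.false_eq_true, if_false]
        ring
      · simp only [BuyerPlan.payA, BuyerPlan.reachA, Bool.false_eq_true, if_false,
          lottery_price_toReal hz ha0 le_rfl]
        ring
    -- Taking less than the full lottery at Alice's shop is optimal only if Bob's option is worth at
    -- least v - p; visiting Bob first is then no worse, and strictly better unless b = 1. With b =
    -- 1 the buyer counts as a Bob-first buyer, and nothing is claimed about the payment to Alice.
    · left
      have h1 : v - p ≤ v * b - (B.price b).toReal := by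
        by_contra! h
        nlinarith [mul_pos (sub_pos.2 halt) (sub_pos.2 h)]
      have h2 : 0 ≤ a * (v * b - (B.price b).toReal - (v - p)) :=
        mul_nonneg ha0 (by linarith)
      have hb1 : b = 1 := by
        by_contra h
        have h3 : b < 1 := lt_of_le_of_ne hb.2 h
        nlinarith [mul_pos (sub_pos.2 h3) (sub_pos.2 hvp)]
      subst hb1
      refine ⟨hcw (by linarith), by linarith, ?_, Or.inl rfl⟩
      simp only [BuyerPlan.payB, BuyerPlan.reachB, Bool.false_eq_true, if_false]
      nlinarith [mul_nonneg ha0 hprice]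
  · rw [utility_bobFirst ha0 ha2] at L1 L2 L3 L4
    left
    have h1 : 0 ≤ (1 - b) * ((1 / 2 - a) * (v - p)) :=
      mul_nonneg (by linarith [hb.2]) (mul_nonneg (by linarith) (by linarith))
    refine ⟨hcw (by linarith), by linarith, ?_, ?_⟩
    · simp [BuyerPlan.payB, BuyerPlan.reachB]
    · rcases hb.2.eq_or_lt with h | h
      · exact Or.inl h
      · right
        have h2 : a = 1 / 2 := by
          by_contra h3
          have h4 : a < 1 / 2 := lt_of_le_of_ne ha2 h3
          nlinarith [mul_pos (sub_pos.2 h) (mul_pos (sub_pos.2 h4) (sub_pos.2 hvp))]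
        subst h2
        simp only [BuyerPlan.payA, BuyerPlan.reachA, if_true,
          lottery_price_toReal hz ha0 le_rfl]
        ring

/-- If Bob sells nothing to the effective value `(v + p) / 2`, or if visiting Alice first is
strictly better, then the buyer takes Alice's lottery with certainty. -/
theorem payA_eq (hx : IsGreatestSelection B x) (hvp : p < v)
    (hs : s.Optimal (lottery p (1 / 2) hz) B v)
    (h : x ((v + p) / 2) = 0 ∨ indirectUtility B x ((v + p) / 2) < indirectUtility B x v / 2) :
    s.payA (lottery p (1 / 2) hz) = p / 2 := by
  rcases optimal_of_gt hx.1 hvp hs with ⟨h1, h2, -, h4⟩ | ⟨-, -, -, h4⟩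
  · rcases h with h | h
    · have hp := p.2
      have h5 := hx.2 _ (by have := hp.trans hvp.le; positivity) _ h1
      have h6 : s.b = 0 := le_antisymm (h5.trans h.le) h1.1.1
      rw [h6] at h4
      rcases h4 with h4 | h4
      · norm_num at h4
      · linarith
    · linarith
  · exact h4

end HalfLottery

/-! ### Bounds on the revenue -/

/-- By Tonelli, a seller facing random values is bounded by the ν-average of posted prices `s`, each
with demand ∫ K(v, s) D(dv). -/
theorem lintegral_le_of_kernel {D ν : Measure ℝ} [SFinite D] [SFinite ν] {K : ℝ → ℝ → ℝ≥0∞}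
    (hK : Measurable (Function.uncurry K)) {g : ℝ → ℝ≥0∞}
    (h : ∀ᵐ v ∂D, g v ≤ ∫⁻ s, ENNReal.ofReal s * K v s ∂ν) :
    ∫⁻ v, g v ∂D ≤ ∫⁻ s, ENNReal.ofReal s * ∫⁻ v, K v s ∂D ∂ν := by
  refine (lintegral_mono_ae h).trans ?_
  rw [lintegral_lintegral_swap]
  · refine (lintegral_congr fun s => ?_).le
    exact lintegral_const_mul _ (hK.comp (measurable_id.prodMk measurable_const))
  · exact ((ENNReal.measurable_ofReal.comp measurable_snd).mul hK).aemeasurable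

theorem setLIntegral_Iic_le {ν : Measure ℝ} {w : ℝ} {k : ℝ → ℝ≥0∞} {c : ℝ≥0∞}
    (hk : ∀ s ≤ w, c ≤ k s) :
    c * ∫⁻ s in Iic w, ENNReal.ofReal s ∂ν ≤ ∫⁻ s, ENNReal.ofReal s * k s ∂ν := by
  rw [← lintegral_const_mul _ ENNReal.measurable_ofReal, ← lintegral_indicator measurableSet_Iic]
  refine lintegral_mono fun s => ?_
  by_cases hs : s ≤ w
  · rw [indicator_of_mem (mem_Iic.2 hs), mul_comm]
    exact mul_le_mul_right (hk s hs) _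
  · rw [indicator_of_notMem (by simpa using hs)]
    exact zero_le

/-! ### Optimality of posted prices for a monopolist -/

section Monopoly

variable {D : Measure ℝ} [IsProbabilityMeasure D] {f : ℝ → ℝ}

theorem ae_nonneg_of_Iio_zero {D : Measure ℝ} (hD : D (Iio 0) = 0) : ∀ᵐ v ∂D, 0 ≤ v := by
  filter_upwards [measure_eq_zero_iff_ae_notMem.1 hD] with s hs using not_lt.1 hs

theorem IsDensity.ofReal_mul_measure_Ici (hf : IsDensity D f) {s : ℝ} (hs : 0 ≤ s) :
    ENNReal.ofReal s * D (Ici s) = ENNReal.ofReal (revenueCurve D s) := by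
  rw [hf.measure_Ici, ← ENNReal.ofReal_mul hs, revenueCurve]

/-- The revenue is at most a mixture, of total mass at most one, of posted-price revenues Γ(s), each
at most Γ(v). -/
theorem IsDensity.lintegral_price_le (hf : IsDensity D f) (hD : D (Iio 0) = 0) {v : ℝ}
    (hv : ∀ z, 0 ≤ z → revenueCurve D z ≤ revenueCurve D v) {M : Mechanism} {x : ℝ → ℝ}
    (hx : IsMonopolySelection M x) :
    ∫⁻ w, M.price (x w) ∂D ≤ ENNReal.ofReal (revenueCurve D v) := by
  obtain ⟨ν, hν⟩ := hx.exists_isMarginalPriceLaw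
  have := hν.isFiniteMeasure
  have hK : Measurable (Function.uncurry fun v s : ℝ => if s ≤ v then (1 : ℝ≥0∞) else 0) :=
    Measurable.ite (measurableSet_le measurable_snd measurable_fst) measurable_const
      measurable_const
  have h1 := lintegral_le_of_kernel (D := D) (ν := ν) hK (g := fun w => M.price (x w)) (by
    filter_upwards [ae_nonneg_of_Iio_zero hD] with w hw
    refine (hν.price_le w hw).trans ?_
    rw [← one_mul (∫⁻ s in Iic w, ENNReal.ofReal s ∂ν)]
    exact setLIntegral_Iic_le fun s hs => by rw [if_pos hs])
  refine h1.trans ?_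
  calc ∫⁻ s, ENNReal.ofReal s * ∫⁻ w, (if s ≤ w then (1 : ℝ≥0∞) else 0) ∂D ∂ν
      ≤ ∫⁻ s, ENNReal.ofReal (revenueCurve D v) ∂ν := by
        refine lintegral_mono_ae ?_
        filter_upwards [hν.ae_nonneg] with s hs
        have : ∫⁻ w, (if s ≤ w then (1 : ℝ≥0∞) else 0) ∂D = D (Ici s) := by
          rw [← lintegral_indicator_one measurableSet_Ici]
          refine lintegral_congr fun w => ?_
          simp [indicator]
        rw [this, hf.ofReal_mul_measure_Ici hs]
        exact ENNReal.ofReal_le_ofReal (hv s hs)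
    _ ≤ ENNReal.ofReal (revenueCurve D v) := by
        rw [lintegral_const]
        exact mul_le_of_le_one_right' hν.univ_le

theorem isMonopolySelection_postedPrice (v : ℝ≥0) :
    IsMonopolySelection (lottery v 1 (by simp)) (fun w => if (v : ℝ) ≤ w then 1 else 0) := by
  intro w hw
  have hz : (1 : ℝ) ∈ Icc (0 : ℝ) 1 := by simp
  by_cases h : (v : ℝ) ≤ w
  · simp only [h, if_true]
    refine ⟨hz, (lottery_price_ne_top hz).2 le_rfl, fun y hy _ => ?_⟩
    rw [lottery_price_toReal hz hy.1 hy.2, lottery_price_toReal hz zero_le_one le_rfl]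
    nlinarith [mul_nonneg (sub_nonneg.2 h) (sub_nonneg.2 hy.2)]
  · simp only [h, if_false]
    refine ⟨by simp, (lottery_price_ne_top hz).2 zero_le_one, fun y hy _ => ?_⟩
    rw [lottery_price_toReal hz hy.1 hy.2, lottery_price_toReal hz le_rfl zero_le_one]
    nlinarith [mul_nonneg (sub_nonneg.2 (not_le.1 h).le) hy.1]

/-- The optimal revenue of a monopolist is attained by a posted price. -/
theorem IsDensity.monopolyRev_eq (hf : IsDensity D f) (hD : D (Iio 0) = 0) {v : ℝ≥0}
    (hv : ∀ z, 0 ≤ z → revenueCurve D z ≤ revenueCurve D v) :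
    monopolyRev D = ENNReal.ofReal (revenueCurve D v) := by
  refine le_antisymm (sSup_le ?_) (le_sSup_of_le ⟨_, _, isMonopolySelection_postedPrice v, rfl⟩ ?_)
  · rintro r ⟨M, x, hx, rfl⟩
    exact hf.lintegral_price_le hD hv hx
  · rw [← hf.ofReal_mul_measure_Ici v.coe_nonneg, ← setLIntegral_const]
    rw [← lintegral_indicator measurableSet_Ici]
    refine lintegral_mono fun w => ?_
    by_cases h : (v : ℝ) ≤ w
    · have hz : (1 : ℝ) ∈ Icc (0 : ℝ) 1 := by simp
      have h1 := lottery_price_toReal (p := v) hz zero_le_one le_rfl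
      rw [indicator_of_mem (mem_Ici.2 h), if_pos h,
        ← ENNReal.ofReal_toReal ((lottery_price_ne_top (p := v) hz).2 le_rfl), h1, mul_one]
    · rw [indicator_of_notMem (by simpa using h)]
      exact zero_le

end Monopoly

/-- Up to the factor `-1/2`, the advantage of visiting Bob first that a posted price `s` of Bob
gives to a buyer of value `t`, when Alice sells a lottery with price `p` and probability `1/2`. -/
noncomputable def tent (p t s : ℝ) : ℝ := min (s - p) (max (t - s) 0)

/-- The left side compares Bob first with Alice first for a posted price `s`. Prices below `p` favor
Bob first, prices between `p` and `t` favor Alice first, and prices from `t` on leave the buyer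
indifferent. -/
theorem tent_eq {p t : ℝ} (h : p ≤ t) (s : ℝ) :
    max ((t + p) / 2 - s) 0 - max (t - s) 0 / 2 = -(1 / 2) * tent p t s := by
  rw [tent]
  rcases le_total (t - s) 0 with h1 | h1
  · rw [max_eq_right h1, max_eq_right (by linarith), min_eq_right (by linarith)]
    ring
  · rw [max_eq_left h1]
    rcases le_total (s - p) (t - s) with h2 | h2
    · rw [min_eq_left h2, max_eq_left (by linarith)]; ring
    · rw [min_eq_right h2, max_eq_right (by linarith)]; ring

theorem tent_mono {p t t' : ℝ} (h : t ≤ t') (s : ℝ) : tent p t s ≤ tent p t' s :=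
  min_le_min le_rfl (max_le_max (by linarith) le_rfl)

namespace IsMarginalPriceLaw

variable {B : Mechanism} {x : ℝ → ℝ} {ν : Measure ℝ}

theorem integrable_tent (hν : IsMarginalPriceLaw B x ν) {p t : ℝ} (hp : 0 ≤ p) (ht : p ≤ t) :
    Integrable (tent p t) ν := by
  have := hν.isFiniteMeasure
  refine Integrable.of_bound (C := t) (by unfold tent; fun_prop) ?_
  filter_upwards [hν.ae_nonneg] with s hs
  rw [Real.norm_eq_abs, abs_le, tent]
  constructor
  · exact le_min (by linarith) ((by linarith : -t ≤ 0).trans (le_max_right _ _))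
  · exact (min_le_right _ _).trans (max_le (by linarith) (by linarith))

theorem integrable_posPart (hν : IsMarginalPriceLaw B x ν) {w : ℝ} (hw : 0 ≤ w) :
    Integrable (fun s => max (w - s) 0) ν := by
  have := hν.isFiniteMeasure
  refine Integrable.of_bound (C := w) (by fun_prop) ?_
  filter_upwards [hν.ae_nonneg] with s hs
  rw [Real.norm_eq_abs, abs_of_nonneg (le_max_right _ _)]
  exact max_le (by linarith) hw

theorem utility_sub (hν : IsMarginalPriceLaw B x ν) {p t : ℝ} (hp : 0 ≤ p) (ht : p ≤ t) :
    indirectUtility B x ((t + p) / 2) - indirectUtility B x t / 2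
      = -(1 / 2) * ∫ s, tent p t s ∂ν := by
  have h0 : 0 ≤ (t + p) / 2 := by linarith
  rw [hν.utility_eq _ h0, hν.utility_eq t (hp.trans ht), ← integral_div,
    ← integral_sub (hν.integrable_posPart h0) ((hν.integrable_posPart (hp.trans ht)).div_const 2),
    ← integral_const_mul]
  exact integral_congr_ae (Eventually.of_forall fun s => tent_eq ht s)

/-- The advantage of visiting Bob first decreases with the value of the buyer. -/
theorem utility_sub_antitone (hν : IsMarginalPriceLaw B x ν) {p t t' : ℝ} (hp : 0 ≤ p)
    (ht : p ≤ t) (htt : t ≤ t') :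
    indirectUtility B x ((t' + p) / 2) - indirectUtility B x t' / 2
      ≤ indirectUtility B x ((t + p) / 2) - indirectUtility B x t / 2 := by
  rw [hν.utility_sub hp ht, hν.utility_sub hp (ht.trans htt)]
  have := integral_mono (hν.integrable_tent hp ht) (hν.integrable_tent hp (ht.trans htt))
    (fun s => tent_mono htt s)
  linarith

end IsMarginalPriceLaw

/-! ### Bounds on the revenue from a single posted price of Bob -/

section RevenueCurve

variable {D : Measure ℝ} {p m : ℝ}

/-- A Bob-first buyer accepts the price `s` from the value max(s, 2s - p) on. For s ≥ p put q = 2s -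
p: then s is the midpoint of `p` and q, so the revenue is the mean of Γ(q) and p(1 - F(q)) ≤ Γ(p),
and the supergradient at q loses its factor 2. -/
theorem mul_one_sub_cdf_le (hp : 0 ≤ p)
    (hm : ∀ q, 0 ≤ q → revenueCurve D q ≤ revenueCurve D p + m * (q - p)) {s : ℝ} (hs : 0 ≤ s) :
    s * (1 - cdf D (max s (2 * s - p))) ≤ revenueCurve D p + m * (s - p) := by
  rcases le_total s p with h | h
  · rw [max_eq_left (by linarith)]
    exact hm s hs
  · rw [max_eq_right (by linarith)]
    have h1 := hm (2 * s - p) (by linarith)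
    have h2 := monotone_cdf D (show p ≤ 2 * s - p by linarith)
    have h3 := mul_le_mul_of_nonneg_left h2 hp
    rw [revenueCurve] at h1
    have h4 : revenueCurve D p = p * (1 - cdf D p) := rfl
    linarith

/-- Revenue from values below `t` when all of them visit Bob first. A price above (t + p)/2 sells to
none of them. -/
theorem mul_cdf_sub_le (hp : 0 ≤ p) (hm0 : 0 ≤ m)
    (hm : ∀ q, 0 ≤ q → revenueCurve D q ≤ revenueCurve D p + m * (q - p)) {t : ℝ} (ht : p ≤ t)
    {s : ℝ} (hs : 0 ≤ s) :
    s * max (cdf D t - cdf D (max s (2 * s - p))) 0 ≤ revenueCurve D p + m * tent p t s := by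
  have hG : 0 ≤ revenueCurve D p := mul_nonneg hp (sub_nonneg.2 (cdf_le_one D p))
  rw [tent]
  rcases le_total s ((t + p) / 2) with h | h
  · have h1 : max s (2 * s - p) ≤ t := max_le (by linarith) (by linarith)
    rw [max_eq_left (a := cdf D t - _) (sub_nonneg.2 (monotone_cdf D h1)),
      max_eq_left (a := t - s) (by linarith), min_eq_left (by linarith)]
    refine le_trans ?_ (mul_one_sub_cdf_le hp hm hs)
    exact mul_le_mul_of_nonneg_left (sub_le_sub_right (cdf_le_one D t) _) hs
  · have h1 : t ≤ max s (2 * s - p) := le_max_of_le_right (by linarith)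
    rw [max_eq_right (a := cdf D t - _) (sub_nonpos.2 (monotone_cdf D h1)), mul_zero]
    have : 0 ≤ min (s - p) (max (t - s) 0) := le_min (by linarith) (le_max_right _ _)
    positivity

/-- Values above `t` visit Alice first and reach Bob half of the time. The coefficient of `tent` is
the same for all `s`, so that it drops out once the indifference at `t` is integrated; its sign does
not matter. -/
theorem mul_cdf_sub_add_le {v : ℝ} (hv : ∀ z, 0 ≤ z → revenueCurve D z ≤ revenueCurve D v)
    (hp : 0 ≤ p) (hm0 : 0 ≤ m)
    (hm : ∀ q, 0 ≤ q → revenueCurve D q ≤ revenueCurve D p + m * (q - p)) {t : ℝ} (ht : p ≤ t)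
    {s : ℝ} (hs : 0 ≤ s) :
    s * max (cdf D t - cdf D (max s (2 * s - p))) 0 + s * ((1 - cdf D (max t s)) / 2)
      ≤ (if s ≤ (t + p) / 2 then revenueCurve D p else revenueCurve D v / 2)
        + (m - (1 - cdf D t) / 2) * tent p t s := by
  have hk : 0 ≤ 1 - cdf D t := sub_nonneg.2 (cdf_le_one D t)
  rw [tent]
  split_ifs with h
  · have h1 : max s (2 * s - p) ≤ t := max_le (by linarith) (by linarith)
    rw [max_eq_left (a := cdf D t - _) (sub_nonneg.2 (monotone_cdf D h1)),
      max_eq_left (a := t - s) (by linarith), min_eq_left (a := s - p) (by linarith),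
      max_eq_left (a := t) (by linarith)]
    have h2 := mul_one_sub_cdf_le hp hm hs
    have h3 := mul_nonneg hp hk
    linarith
  · rw [not_le] at h
    have h1 : t ≤ max s (2 * s - p) := le_max_of_le_right (by linarith)
    rw [max_eq_right (a := cdf D t - _) (sub_nonpos.2 (monotone_cdf D h1)), mul_zero, zero_add]
    rcases le_total s t with h2 | h2
    · rw [max_eq_left h2, max_eq_left (a := t - s) (by linarith), min_eq_right (by linarith)]
      have h3 := hv t (hp.trans ht)
      rw [revenueCurve] at h3
      have h4 := mul_nonneg hm0 (sub_nonneg.2 h2)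
      linarith
    · rw [max_eq_right h2, max_eq_right (a := t - s) (by linarith), min_eq_right (by linarith)]
      have h3 := hv s hs
      rw [revenueCurve] at h3
      linarith

end RevenueCurve

/-! ### Bob's revenue against a lottery of Alice -/

section HalfLottery

variable {D : Measure ℝ} {f : ℝ → ℝ} {σ : BuyerRule} {p : ℝ≥0}
  {hz : (1 / 2 : ℝ) ∈ Icc (0 : ℝ) 1} {B : Mechanism} {x : ℝ → ℝ} {t : ℝ}

theorem price_le_of_choice (hx : IsGreatestSelection B x) {w y : ℝ} (hw : 0 ≤ w)
    (hy : IsMonopolyChoice B w y) : B.price y ≤ B.price (x w) :=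
  B.monotoneOn hy.1 (hx.1 w hw).1 (hx.2 w hw y hy)

/-- Below the threshold value `t` up to which it is optimal to visit Bob first, Bob is paid at most
as much as by the effective value `min v ((v + p) / 2)`. -/
theorem ae_payB_le_of_lt (hf : IsDensity D f) (hD : D (Iio 0) = 0) (hσ : σ.IsOptimal)
    (hx : IsGreatestSelection B x)
    (ht : ∀ w, (p : ℝ) < w → w < t →
      indirectUtility B x w / 2 ≤ indirectUtility B x ((w + p) / 2)) :
    ∀ᵐ v ∂D, v < t → ENNReal.ofReal ((σ (lottery p (1 / 2) hz) B v).payB B)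
      ≤ B.price (x (min v ((v + p) / 2))) := by
  have hnull := hf.nullSingletonClass
  have hp := p.coe_nonneg
  set X : ℝ → ℝ := fun w => if w < 0 then 0 else x w with hX
  have hXmono : Monotone X := monotone_of_subgradient hx.1.subgradient_extend
  have hXx : ∀ w, 0 ≤ w → X w = x w := fun w hw => if_neg (not_lt.2 hw)
  have hc : {v : ℝ | ¬ ContinuousAt X ((v + p) / 2)}.Countable := by
    refine hXmono.countable_not_continuousAt.preimage (f := fun v : ℝ => (v + p) / 2) ?_
    intro a b hab
    simp only at hab
    linarith
  have hc' : ({(p : ℝ)} : Set ℝ).Countable := countable_singleton _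
  filter_upwards [ae_nonneg_of_Iio_zero hD, hc.ae_notMem D, hc'.ae_notMem D] with v hv hcont hvp hvt
  have hopt := hσ (lottery p (1 / 2) hz) B v hv
  rcases lt_or_gt_of_ne (show v ≠ p from hvp) with hlt | hgt
  · rw [min_eq_left (by linarith)]
    exact (ENNReal.ofReal_le_ofReal (payB_le_of_lt hx hv hlt hopt)).trans ENNReal.ofReal_toReal_le
  · rw [min_eq_right (by linarith)]
    have hw : 0 ≤ (v + p) / 2 := by positivity
    rcases optimal_of_gt hx.1 hgt hopt with ⟨h1, -, h3, -⟩ | ⟨h1, h2, h3, -⟩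
    · exact (ENNReal.ofReal_le_ofReal h3).trans
        (ENNReal.ofReal_toReal_le.trans (price_le_of_choice hx hw h1))
    -- Such a buyer is indifferent and visits Alice first. On (v, t) Bob first stays optimal, so
    -- U((u + p)/2) grows at least as fast as U(u)/2 to the right of `v`. This compares the slopes
    -- at (u + p)/2 and `v`, and u ↓ v needs continuity of the slope at (v + p)/2, which excludes
    -- only countably many values.
    · have hle : x v ≤ x ((v + p) / 2) := by
        rw [← hXx _ hw]
        have hcont : ContinuousAt X ((v + p) / 2) := not_not.1 hcont
        have hlin : ContinuousAt (fun u : ℝ => (u + p) / 2) v := by fun_prop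
        have hlim : Tendsto (fun u : ℝ => X ((u + p) / 2)) (𝓝[>] v) (𝓝 (X ((v + p) / 2))) :=
          (ContinuousAt.comp (f := fun u : ℝ => (u + p) / 2) hcont hlin).mono_left
            nhdsWithin_le_nhds
        refine ge_of_tendsto hlim ?_
        filter_upwards [Ioo_mem_nhdsGT hvt] with u hu
        have hu0 : 0 ≤ u := hv.trans hu.1.le
        have hw' : 0 ≤ (u + p) / 2 := by positivity
        rw [hXx _ hw']
        have e1 := ht u (hgt.trans hu.1) hu.2
        have e2 := hx.1.subgradient hv hu0
        have e3 := hx.1.subgradient hw' hw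
        have e4 : x v * (u - v) ≤ x ((u + p) / 2) * (u - v) := by linarith
        exact le_of_mul_le_mul_right e4 (sub_pos.2 hu.1)
      have h4 : (σ (lottery p (1 / 2) hz) B v).payB B
          ≤ (B.price (σ (lottery p (1 / 2) hz) B v).b).toReal := by
        rw [h3]
        linarith [ENNReal.toReal_nonneg (a := B.price (σ (lottery p (1 / 2) hz) B v).b)]
      exact (ENNReal.ofReal_le_ofReal h4).trans (ENNReal.ofReal_toReal_le.trans
        ((price_le_of_choice hx hv h1).trans
          (B.monotoneOn (hx.1 v hv).1 (hx.1 _ hw).1 hle)))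

theorem payB_le_of_gt (hσ : σ.IsOptimal) (hx : IsGreatestSelection B x) {v : ℝ} (hpv : p < v)
    (h : indirectUtility B x ((v + p) / 2) < indirectUtility B x v / 2) :
    ENNReal.ofReal ((σ (lottery p (1 / 2) hz) B v).payB B) ≤ 2⁻¹ * B.price (x v) := by
  have hv : 0 ≤ v := p.coe_nonneg.trans hpv.le
  rcases optimal_of_gt hx.1 hpv (hσ (lottery p (1 / 2) hz) B v hv) with ⟨-, h2, -⟩ | ⟨h1, -, h3, -⟩
  · exact absurd h (not_lt.2 h2)
  · rw [h3, div_eq_inv_mul, ENNReal.ofReal_mul (by norm_num), ENNReal.ofReal_inv_of_pos two_pos,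
      ENNReal.ofReal_ofNat]
    gcongr
    exact ENNReal.ofReal_toReal_le.trans (price_le_of_choice hx hv h1)

theorem lintegral_ite {D : Measure ℝ} {P : ℝ → Prop} [DecidablePred P]
    (hP : MeasurableSet {v | P v}) (c : ℝ≥0∞) :
    ∫⁻ v, (if P v then c else 0) ∂D = c * D {v | P v} := by
  rw [← lintegral_indicator_const hP]
  exact lintegral_congr fun v => by simp [indicator]

theorem setOf_le_min_eq (p t s : ℝ) :
    {v : ℝ | v < t ∧ s ≤ min v ((v + p) / 2)} = Ico (max s (2 * s - p)) t := by
  ext v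
  simp only [mem_ofPred_eq, mem_Ico, le_min_iff, max_le_iff]
  constructor
  · rintro ⟨h1, h2, h3⟩; exact ⟨⟨h2, by linarith⟩, h1⟩
  · rintro ⟨⟨h1, h2⟩, h3⟩; exact ⟨h3, h1, by linarith⟩

theorem measurable_bobFirst (p t : ℝ) : Measurable (Function.uncurry fun v s : ℝ =>
    if v < t ∧ s ≤ min v ((v + p) / 2) then (1 : ℝ≥0∞) else 0) := by
  refine Measurable.ite ?_ measurable_const measurable_const
  exact (measurableSet_lt measurable_fst measurable_const).inter
    (measurableSet_le measurable_snd (by fun_prop))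

theorem measurable_aliceFirst (t : ℝ) : Measurable (Function.uncurry fun v s : ℝ =>
    if t < v ∧ s ≤ v then (2⁻¹ : ℝ≥0∞) else 0) := by
  refine Measurable.ite ?_ measurable_const measurable_const
  exact (measurableSet_lt measurable_const measurable_fst).inter
    (measurableSet_le measurable_snd measurable_fst)

variable [IsProbabilityMeasure D]

theorem lintegral_bobFirst (hf : IsDensity D f) (p t s : ℝ) :
    ∫⁻ v, (if v < t ∧ s ≤ min v ((v + p) / 2) then (1 : ℝ≥0∞) else 0) ∂D
      = ENNReal.ofReal (max (cdf D t - cdf D (max s (2 * s - p))) 0) := by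
  rw [lintegral_ite (by rw [setOf_le_min_eq]; exact measurableSet_Ico), setOf_le_min_eq,
    hf.measure_Ico, one_mul]
  rcases le_total (cdf D t - cdf D (max s (2 * s - p))) 0 with h | h
  · rw [max_eq_right h, ENNReal.ofReal_of_nonpos h, ENNReal.ofReal_zero]
  · rw [max_eq_left h]

theorem lintegral_aliceFirst_le (hf : IsDensity D f) (t s : ℝ) :
    ∫⁻ v, (if t < v ∧ s ≤ v then (2⁻¹ : ℝ≥0∞) else 0) ∂D
      ≤ ENNReal.ofReal ((1 - cdf D (max t s)) / 2) := by
  rw [lintegral_ite (P := fun v => t < v ∧ s ≤ v) (measurableSet_Ioi.inter measurableSet_Ici),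
    div_eq_inv_mul,
    ENNReal.ofReal_mul (by norm_num), ENNReal.ofReal_inv_of_pos two_pos, ENNReal.ofReal_ofNat,
    ← hf.measure_Ici]
  gcongr
  rintro v ⟨h1, h2⟩
  exact max_le h1.le h2

/-- If it is optimal to visit Bob first for all values between `p` and `t`, then Bob's revenue from
values below `t` is at most the revenue of the posted price `p`. -/
theorem setLIntegral_payB_le (hf : IsDensity D f) (hD : D (Iio 0) = 0) (hσ : σ.IsOptimal)
    (hx : IsGreatestSelection B x) {ν : Measure ℝ} (hν : IsMarginalPriceLaw B x ν) {m : ℝ}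
    (hm0 : 0 ≤ m) (hm : ∀ q, 0 ≤ q → revenueCurve D q ≤ revenueCurve D p + m * (q - p))
    (hpt : p ≤ t)
    (ht : ∀ w, (p : ℝ) < w → w ≤ t →
      indirectUtility B x w / 2 ≤ indirectUtility B x ((w + p) / 2)) :
    ∫⁻ v in Iio t, ENNReal.ofReal ((σ (lottery p (1 / 2) hz) B v).payB B) ∂D
      ≤ ENNReal.ofReal (revenueCurve D p) := by
  have := hν.isFiniteMeasure
  have hp := p.coe_nonneg
  have hG : 0 ≤ revenueCurve D p := mul_nonneg hp (sub_nonneg.2 (cdf_le_one D p))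
  rw [← lintegral_indicator measurableSet_Iio]
  refine (lintegral_le_of_kernel (ν := ν) (measurable_bobFirst p t) ?_).trans ?_
  · filter_upwards [ae_payB_le_of_lt (hz := hz) hf hD hσ hx (fun w h1 h2 => ht w h1 h2.le),
      ae_nonneg_of_Iio_zero hD] with v h1 hv
    by_cases hvt : v < t
    · rw [indicator_of_mem (mem_Iio.2 hvt)]
      refine (h1 hvt).trans ((hν.price_le _ (le_min hv (by positivity))).trans ?_)
      rw [← one_mul (∫⁻ s in Iic _, ENNReal.ofReal s ∂ν)]
      exact setLIntegral_Iic_le fun s hs => by rw [if_pos ⟨hvt, hs⟩]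
    · rw [indicator_of_notMem (by simpa using hvt)]
      exact zero_le
  · have hbound : ∀ᵐ s ∂ν, s * max (cdf D t - cdf D (max s (2 * s - p))) 0
        ≤ revenueCurve D p + m * tent p t s := by
      filter_upwards [hν.ae_nonneg] with s hs using mul_cdf_sub_le hp hm0 hm hpt hs
    have hint : Integrable (fun s => revenueCurve D p + m * tent p t s) ν :=
      (integrable_const _).add ((hν.integrable_tent hp hpt).const_mul m)
    calc ∫⁻ s, ENNReal.ofReal s * ∫⁻ v, (if v < t ∧ s ≤ min v ((v + p) / 2) then
          (1 : ℝ≥0∞) else 0) ∂D ∂ν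
        ≤ ∫⁻ s, ENNReal.ofReal (revenueCurve D p + m * tent p t s) ∂ν := by
          refine lintegral_mono_ae ?_
          filter_upwards [hν.ae_nonneg, hbound] with s hs hb
          rw [lintegral_bobFirst hf, ← ENNReal.ofReal_mul hs]
          exact ENNReal.ofReal_le_ofReal hb
      _ = ENNReal.ofReal (∫ s, (revenueCurve D p + m * tent p t s) ∂ν) := by
          refine (ofReal_integral_eq_lintegral_ofReal hint ?_).symm
          filter_upwards [hν.ae_nonneg, hbound] with s hs hb
          exact le_trans (mul_nonneg hs (le_max_right _ _)) hb
      _ ≤ ENNReal.ofReal (revenueCurve D p) := by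
          refine ENNReal.ofReal_le_ofReal ?_
          rw [integral_add (integrable_const _) ((hν.integrable_tent hp hpt).const_mul m),
            integral_const, integral_const_mul, smul_eq_mul]
          have h1 : ν.real univ ≤ 1 := by
            rw [measureReal_def]
            exact ENNReal.toReal_le_of_le_ofReal zero_le_one (by simpa using hν.univ_le)
          have h2 := hν.utility_sub hp hpt
          -- Here `t` need not be an indifference point: only the sign of the `tent` integral is
          -- known, and 0 ≤ m turns it into a bound.
          have h3 : 0 ≤ indirectUtility B x ((t + p) / 2) - indirectUtility B x t / 2 := by
            rcases hpt.eq_or_lt with h | h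
            · rw [← h, add_self_div_two]
              linarith [hx.1.indirectUtility_nonneg hp]
            · linarith [ht t h le_rfl]
          have h4 : ∫ s, tent p t s ∂ν ≤ 0 := by linarith
          have h5 := mul_nonpos_of_nonneg_of_nonpos hm0 h4
          have h6 := mul_le_of_le_one_left hG h1
          linarith

/-- If visiting Bob first is optimal exactly below the value `t`, then Bob's revenue falls short of
half the optimal revenue in proportion to the probability sold to the effective value
`(t + p) / 2`. -/
theorem revB_le_of_threshold (hf : IsDensity D f) (hD : D (Iio 0) = 0) (hσ : σ.IsOptimal) {v : ℝ}
    (hv : ∀ z, 0 ≤ z → revenueCurve D z ≤ revenueCurve D v)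
    (hx : IsGreatestSelection B x) {ν : Measure ℝ} (hν : IsMarginalPriceLaw B x ν) {m : ℝ}
    (hm0 : 0 ≤ m) (hm : ∀ q, 0 ≤ q → revenueCurve D q ≤ revenueCurve D p + m * (q - p))
    (hpv : revenueCurve D p ≤ revenueCurve D v / 2) (hpt : p ≤ t)
    (hlt : ∀ w, (p : ℝ) < w → w < t →
      indirectUtility B x w / 2 ≤ indirectUtility B x ((w + p) / 2))
    (heq : indirectUtility B x t / 2 = indirectUtility B x ((t + p) / 2))
    (hgt : ∀ w, t < w → indirectUtility B x ((w + p) / 2) < indirectUtility B x w / 2) :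
    revB σ D (lottery p (1 / 2) hz) B ≤ ENNReal.ofReal (revenueCurve D v / 2
      - (revenueCurve D v / 2 - revenueCurve D p) * x ((t + p) / 2)) := by
  have := hν.isFiniteMeasure
  have hnull := hf.nullSingletonClass
  have hp := p.coe_nonneg
  have hV : 0 ≤ revenueCurve D v := by
    refine le_trans ?_ (hv 0 le_rfl)
    simp [revenueCurve]
  have hc : ({t} : Set ℝ).Countable := countable_singleton _
  refine (lintegral_le_of_kernel (ν := ν)
    (K := fun v s => (if v < t ∧ s ≤ min v ((v + p) / 2) then (1 : ℝ≥0∞) else 0)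
      + (if t < v ∧ s ≤ v then (2⁻¹ : ℝ≥0∞) else 0))
    ((measurable_bobFirst p t).add (measurable_aliceFirst t)) ?_).trans ?_
  · filter_upwards [ae_payB_le_of_lt (hz := hz) hf hD hσ hx hlt,
      ae_nonneg_of_Iio_zero hD, hc.ae_notMem D] with u h1 hu hut
    rcases lt_or_gt_of_ne (show u ≠ t from hut) with h | h
    · refine (h1 h).trans ((hν.price_le _ (le_min hu (by positivity))).trans ?_)
      rw [← one_mul (∫⁻ s in Iic _, ENNReal.ofReal s ∂ν)]
      exact setLIntegral_Iic_le fun s hs => by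
        rw [if_pos ⟨h, hs⟩]
        exact le_self_add
    · refine (payB_le_of_gt hσ hx (hpt.trans_lt h) (hgt u h)).trans
        ((mul_le_mul_right (hν.price_le u hu) _).trans ?_)
      exact setLIntegral_Iic_le fun s hs => by
        rw [if_pos (c := t < u ∧ s ≤ u) ⟨h, hs⟩]
        exact le_add_self
  · set Θ : ℝ → ℝ := fun s =>
      if s ≤ (t + p) / 2 then revenueCurve D p else revenueCurve D v / 2 with hΘ
    set l := m - (1 - cdf D t) / 2 with hl
    have hbound : ∀ᵐ s ∂ν, s * max (cdf D t - cdf D (max s (2 * s - p))) 0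
        + s * ((1 - cdf D (max t s)) / 2) ≤ Θ s + l * tent p t s := by
      filter_upwards [hν.ae_nonneg] with s hs using mul_cdf_sub_add_le hv hp hm0 hm hpt hs
    have hΘeq : Θ = fun s => revenueCurve D v / 2 - (Iic ((t + p) / 2)).indicator
        (fun _ => revenueCurve D v / 2 - revenueCurve D p) s := by
      funext s
      by_cases hs : s ≤ (t + p) / 2 <;> simp [hΘ, indicator, hs]
    have hind : Integrable ((Iic ((t + p) / 2)).indicator
        (fun _ : ℝ => revenueCurve D v / 2 - revenueCurve D p)) ν :=
      (integrable_const _).indicator measurableSet_Iic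
    have hΘint : Integrable Θ ν := by
      rw [hΘeq]
      exact (integrable_const _).sub hind
    have hint : Integrable (fun s => Θ s + l * tent p t s) ν :=
      hΘint.add ((hν.integrable_tent hp hpt).const_mul l)
    have hnn : ∀ s, 0 ≤ s → 0 ≤ s * max (cdf D t - cdf D (max s (2 * s - p))) 0 := fun s hs =>
      mul_nonneg hs (le_max_right _ _)
    have hnn' : ∀ s, 0 ≤ s → 0 ≤ s * ((1 - cdf D (max t s)) / 2) := fun s hs =>
      mul_nonneg hs (div_nonneg (sub_nonneg.2 (cdf_le_one D _)) two_pos.le)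
    calc ∫⁻ s, ENNReal.ofReal s * ∫⁻ v, ((if v < t ∧ s ≤ min v ((v + p) / 2) then
          (1 : ℝ≥0∞) else 0) + (if t < v ∧ s ≤ v then (2⁻¹ : ℝ≥0∞) else 0)) ∂D ∂ν
        ≤ ∫⁻ s, ENNReal.ofReal (Θ s + l * tent p t s) ∂ν := by
          refine lintegral_mono_ae ?_
          filter_upwards [hν.ae_nonneg, hbound] with s hs hb
          have hmeas : Measurable fun v : ℝ =>
              if v < t ∧ s ≤ min v ((v + p) / 2) then (1 : ℝ≥0∞) else 0 :=
            (measurable_bobFirst p t).comp (measurable_id.prodMk measurable_const)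
          rw [lintegral_add_left hmeas, mul_add]
          refine le_trans ?_ (ENNReal.ofReal_le_ofReal hb)
          rw [ENNReal.ofReal_add (hnn s hs) (hnn' s hs), ENNReal.ofReal_mul hs,
            ENNReal.ofReal_mul hs]
          exact add_le_add (mul_le_mul_right (lintegral_bobFirst hf p t s).le _)
            (mul_le_mul_right (lintegral_aliceFirst_le hf t s) _)
      _ = ENNReal.ofReal (∫ s, (Θ s + l * tent p t s) ∂ν) := by
          refine (ofReal_integral_eq_lintegral_ofReal hint ?_).symm
          filter_upwards [hν.ae_nonneg, hbound] with s hs hb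
          exact le_trans (add_nonneg (hnn s hs) (hnn' s hs)) hb
      _ ≤ _ := by
          refine ENNReal.ofReal_le_ofReal ?_
          have h1 : ν.real univ ≤ 1 := by
            rw [measureReal_def]
            exact ENNReal.toReal_le_of_le_ofReal zero_le_one (by simpa using hν.univ_le)
          have h2 := hν.utility_sub hp hpt
          -- Indifference at `t` is exactly what removes the multiplier term, whatever the sign of
          -- `l`.
          have h3 : ∫ s, tent p t s ∂ν = 0 := by linarith
          rw [integral_add hΘint ((hν.integrable_tent hp hpt).const_mul l), integral_const_mul, h3,
            mul_zero, add_zero, hΘeq, integral_sub (integrable_const _) hind, integral_const,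
            integral_indicator_const _ measurableSet_Iic, smul_eq_mul, smul_eq_mul]
          have h4 : x ((t + p) / 2) ≤ ν.real (Iic ((t + p) / 2)) := by
            rw [measureReal_def]
            exact (ENNReal.ofReal_le_iff_le_toReal (measure_ne_top _ _)).1
              (hν.le_Iic _ (by linarith))
          have h5 := mul_le_mul_of_nonneg_left h4 (sub_nonneg.2 hpv)
          have h6 := mul_le_of_le_one_left (by linarith : 0 ≤ revenueCurve D v / 2) h1
          linarith

/-- Either Bob's revenue is at most that of the posted price `p`, or visiting Alice first is
strictly better above some value `t`, and Bob's revenue falls short of half the optimal revenue in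
proportion to the probability sold to the effective value `(t + p) / 2`. -/
theorem revB_dichotomy (hf : IsDensity D f) (hD : D (Iio 0) = 0) (hσ : σ.IsOptimal) {v : ℝ}
    (hv : ∀ z, 0 ≤ z → revenueCurve D z ≤ revenueCurve D v)
    (hx : IsGreatestSelection B x) {m : ℝ}
    (hm0 : 0 ≤ m) (hm : ∀ q, 0 ≤ q → revenueCurve D q ≤ revenueCurve D p + m * (q - p))
    (hpv : revenueCurve D p ≤ revenueCurve D v / 2) :
    revB σ D (lottery p (1 / 2) hz) B ≤ ENNReal.ofReal (revenueCurve D p) ∨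
    ∃ t : ℝ, (p : ℝ) ≤ t ∧
      (∀ w, t < w → indirectUtility B x ((w + p) / 2) < indirectUtility B x w / 2) ∧
      revB σ D (lottery p (1 / 2) hz) B ≤ ENNReal.ofReal (revenueCurve D v / 2
        - (revenueCurve D v / 2 - revenueCurve D p) * x ((t + p) / 2)) := by
  obtain ⟨ν, hν⟩ := hx.1.exists_isMarginalPriceLaw
  have hp := p.coe_nonneg
  -- The values for which Bob first is optimal form an interval starting at `p`; its supremum, if
  -- finite, is the threshold, and continuity of the indirect utility gives indifference there.
  set S : Set ℝ := {w | (p : ℝ) ≤ w ∧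
    indirectUtility B x w / 2 ≤ indirectUtility B x ((w + p) / 2)} with hS
  have hpS : (p : ℝ) ∈ S := by
    refine ⟨le_rfl, ?_⟩
    rw [add_self_div_two]
    linarith [hx.1.indirectUtility_nonneg hp]
  have hdown : ∀ w w', (p : ℝ) ≤ w → w ≤ w' → w' ∈ S → w ∈ S := by
    intro w w' h1 h2 h3
    have := hν.utility_sub_antitone hp h1 h2
    exact ⟨h1, by linarith [h3.2]⟩
  by_cases hbdd : BddAbove S
  · right
    have hpt : (p : ℝ) ≤ sSup S := le_csSup hbdd hpS
    have hlt : ∀ w, (p : ℝ) < w → w < sSup S → w ∈ S := by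
      intro w h1 h2
      obtain ⟨w', h3, h4⟩ := exists_lt_of_lt_csSup ⟨_, hpS⟩ h2
      exact hdown w w' h1.le h4.le h3
    have hgt : ∀ w, sSup S < w →
        indirectUtility B x ((w + p) / 2) < indirectUtility B x w / 2 := by
      intro w h1
      by_contra! h2
      exact absurd (le_csSup hbdd (show w ∈ S from ⟨hpt.trans h1.le, h2⟩)) (not_le.2 h1)
    have hcontU : Continuous fun w => indirectUtility B x (max w 0) := hx.1.lipschitz.continuous
    have hcont : Continuous fun w => indirectUtility B x (max ((w + p) / 2) 0)
        - indirectUtility B x (max w 0) / 2 :=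
      (hcontU.comp (by fun_prop : Continuous fun w : ℝ => (w + p) / 2)).sub
        (hcontU.div_const 2)
    have hval : ∀ w, (p : ℝ) ≤ w → indirectUtility B x (max ((w + p) / 2) 0)
        - indirectUtility B x (max w 0) / 2
        = indirectUtility B x ((w + p) / 2) - indirectUtility B x w / 2 := by
      intro w h1
      rw [max_eq_left (by linarith), max_eq_left (by linarith)]
    have hle : indirectUtility B x ((sSup S + p) / 2) - indirectUtility B x (sSup S) / 2 ≤ 0 := by
      rw [← hval _ hpt]
      refine le_of_tendsto ((hcont.tendsto (sSup S)).mono_left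
        (nhdsWithin_le_nhds (s := Ioi (sSup S)))) ?_
      filter_upwards [self_mem_nhdsWithin] with w hw
      rw [hval _ (hpt.trans (mem_Ioi.1 hw).le)]
      linarith [hgt w hw]
    have hge : 0 ≤ indirectUtility B x ((sSup S + p) / 2) - indirectUtility B x (sSup S) / 2 := by
      rcases hpt.eq_or_lt with h | h
      · rw [← h]
        linarith [hpS.2]
      · rw [← hval _ hpt]
        refine ge_of_tendsto ((hcont.tendsto (sSup S)).mono_left
          (nhdsWithin_le_nhds (s := Iio (sSup S)))) ?_
        filter_upwards [Ioo_mem_nhdsLT h] with w hw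
        rw [hval _ hw.1.le]
        linarith [(hlt w hw.1 hw.2).2]
    exact ⟨sSup S, hpt, hgt, revB_le_of_threshold hf hD hσ hv hx hν hm0 hm hpv hpt
      (fun w h1 h2 => (hlt w h1 h2).2) (by linarith) hgt⟩
  · left
    have hall : ∀ w, (p : ℝ) ≤ w → w ∈ S := by
      intro w h1
      obtain ⟨w', h2, h3⟩ := not_bddAbove_iff.1 hbdd w
      exact hdown w w' h1 h3.le h2
    -- Without a threshold, the bound for values below p + n holds for every n and passes to the
    -- limit by monotone convergence.
    have hun : (univ : Set ℝ) = ⋃ n : ℕ, Iio ((p : ℝ) + n) := by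
      refine (eq_univ_of_forall fun s => mem_iUnion.2 ?_).symm
      obtain ⟨n, hn⟩ := exists_nat_gt (s - p)
      exact ⟨n, by rw [mem_Iio]; linarith⟩
    have hd : Directed (· ⊆ ·) (fun n : ℕ => Iio ((p : ℝ) + n)) :=
      Monotone.directed_le fun a b hab =>
        Iio_subset_Iio (add_le_add le_rfl (Nat.cast_le.2 hab))
    rw [revB, ← setLIntegral_univ, hun, setLIntegral_iUnion_of_directed _ hd]
    refine iSup_le fun n => ?_
    exact setLIntegral_payB_le hf hD hσ hx hν hm0 hm (by simp)
      (fun w h1 _ => (hall w h1.le).2)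

end HalfLottery

/-! ### The response by a posted price -/

theorem isGreatestSelection_postedPrice (v : ℝ≥0) :
    IsGreatestSelection (lottery v 1 (by simp)) (fun w => if (v : ℝ) ≤ w then 1 else 0) := by
  refine ⟨isMonopolySelection_postedPrice v, fun w hw y hy => ?_⟩
  by_cases h : (v : ℝ) ≤ w
  · simpa only [h, if_true] using hy.1.2
  · simp only [h, if_false]
    have hz : (1 : ℝ) ∈ Icc (0 : ℝ) 1 := by simp
    have h1 := hy.2.2 0 (by simp) ((lottery_price_ne_top hz).2 zero_le_one)
    rw [lottery_price_toReal hz hy.1.1 hy.1.2, lottery_price_toReal hz le_rfl zero_le_one] at h1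
    by_contra! h2
    nlinarith [mul_pos (sub_pos.2 (not_le.1 h)) h2]

theorem indirectUtility_postedPrice (v : ℝ≥0) (w : ℝ) :
    indirectUtility (lottery v 1 (by simp)) (fun w => if (v : ℝ) ≤ w then 1 else 0) w
      = if (v : ℝ) ≤ w then w - v else 0 := by
  have hz : (1 : ℝ) ∈ Icc (0 : ℝ) 1 := by simp
  rw [indirectUtility]
  split_ifs
  · rw [lottery_price_toReal hz zero_le_one le_rfl]; ring
  · rw [lottery_price_toReal hz le_rfl zero_le_one]; ring

section PostedPrice

variable {D : Measure ℝ} [IsProbabilityMeasure D] {f : ℝ → ℝ} {σ : BuyerRule} {p v : ℝ≥0}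
  {hz : (1 / 2 : ℝ) ∈ Icc (0 : ℝ) 1}

theorem postedPrice_aliceFirst (hpv : p < v) {w : ℝ} (hw : v < w) :
    indirectUtility (lottery v 1 (by simp)) (fun w => if (v : ℝ) ≤ w then 1 else 0) ((w + p) / 2)
      < indirectUtility (lottery v 1 (by simp)) (fun w => if (v : ℝ) ≤ w then 1 else 0) w / 2 := by
  rw [indirectUtility_postedPrice, indirectUtility_postedPrice, if_pos hw.le]
  have hpv' : (p : ℝ) < v := by exact_mod_cast hpv
  split_ifs <;> linarith

theorem IsDensity.ofReal_mul_le_lintegral (hf : IsDensity D f) (q : ℝ≥0) {g : ℝ → ℝ}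
    (hg : ∀ w, (q : ℝ) < w → g w = q / 2) :
    ENNReal.ofReal (revenueCurve D q / 2) ≤ ∫⁻ w, ENNReal.ofReal (g w) ∂D := by
  have h1 : ENNReal.ofReal (revenueCurve D q / 2)
      = ∫⁻ w in Ioi (q : ℝ), ENNReal.ofReal (q / 2) ∂D := by
    rw [setLIntegral_const, hf.measure_Ioi, ← ENNReal.ofReal_mul (by positivity), revenueCurve]
    congr 1
    ring
  rw [h1]
  calc ∫⁻ w in Ioi (q : ℝ), ENNReal.ofReal (q / 2) ∂D
      = ∫⁻ w in Ioi (q : ℝ), ENNReal.ofReal (g w) ∂D :=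
        setLIntegral_congr_fun measurableSet_Ioi fun w hw => by simp only [hg w hw]
    _ ≤ _ := setLIntegral_le_lintegral _ _

theorem le_revB_postedPrice (hf : IsDensity D f) (hσ : σ.IsOptimal) (hpv : p < v) :
    ENNReal.ofReal (revenueCurve D v / 2)
      ≤ revB σ D (lottery p (1 / 2) hz) (lottery v 1 (by simp)) := by
  refine hf.ofReal_mul_le_lintegral v fun w hw => ?_
  have hz1 : (1 : ℝ) ∈ Icc (0 : ℝ) 1 := by simp
  have hpv' : (p : ℝ) < v := by exact_mod_cast hpv
  have hw0 : 0 ≤ w := v.coe_nonneg.trans hw.le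
  rcases optimal_of_gt (isMonopolySelection_postedPrice v) (hpv'.trans hw)
    (hσ (lottery p (1 / 2) hz) (lottery v 1 (by simp)) w hw0) with ⟨-, h2, -⟩ | ⟨h1, -, h3, -⟩
  · exact absurd (postedPrice_aliceFirst hpv hw) (not_lt.2 h2)
  · rw [h3]
    have h4 := h1.2.2 1 hz1 ((lottery_price_ne_top hz1).2 le_rfl)
    rw [lottery_price_toReal hz1 h1.1.1 h1.1.2, lottery_price_toReal hz1 zero_le_one le_rfl] at h4
    rw [lottery_price_toReal hz1 h1.1.1 h1.1.2]
    have h5 : (σ (lottery p (1 / 2) hz) (lottery v 1 (by simp)) w).b = 1 := by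
      refine le_antisymm h1.1.2 ?_
      by_contra! h6
      nlinarith [mul_pos (sub_pos.2 hw) (sub_pos.2 h6)]
    rw [h5, mul_one]

/-- Every value above `p` pays Alice p/2, which gives p(1 - F(p))/2 in total. -/
theorem le_revA_of_forall (hf : IsDensity D f) (hσ : σ.IsOptimal) {B : Mechanism} {x : ℝ → ℝ}
    (hx : IsGreatestSelection B x)
    (h : ∀ w, (p : ℝ) < w → x ((w + p) / 2) = 0 ∨
      indirectUtility B x ((w + p) / 2) < indirectUtility B x w / 2) :
    ENNReal.ofReal (revenueCurve D p / 2) ≤ revA σ D (lottery p (1 / 2) hz) B :=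
  hf.ofReal_mul_le_lintegral p fun w hw =>
    payA_eq hx hw (hσ (lottery p (1 / 2) hz) B w (p.coe_nonneg.trans hw.le)) (h w hw)

theorem le_revA_postedPrice (hf : IsDensity D f) (hσ : σ.IsOptimal) (hpv : p < v) :
    ENNReal.ofReal (revenueCurve D p / 2)
      ≤ revA σ D (lottery p (1 / 2) hz) (lottery v 1 (by simp)) := by
  have hpv' : (p : ℝ) < v := by exact_mod_cast hpv
  refine le_revA_of_forall hf hσ (isGreatestSelection_postedPrice v) fun w hw => ?_
  rcases lt_or_ge (v : ℝ) w with h | h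
  · exact Or.inr (postedPrice_aliceFirst hpv h)
  · exact Or.inl (if_neg (by rw [not_le]; linarith))

end PostedPrice

/-! ### Bob's best responses -/

section BestResponse

variable {D : Measure ℝ} [IsProbabilityMeasure D] {f : ℝ → ℝ} {σ : BuyerRule} {p v : ℝ≥0}
  {hz : (1 / 2 : ℝ) ∈ Icc (0 : ℝ) 1}

/-- The Myerson price is a best response to a lottery whose price yields at most half the optimal
revenue. -/
theorem isBestResponse_postedPrice (hf : IsDensity D f) (hD : D (Iio 0) = 0)
    (hreg : IsRegularDist D f ∨ IsDMRDist D f)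
    (hv : ∀ z, 0 ≤ z → revenueCurve D z ≤ revenueCurve D v) (hv1 : cdf D v < 1)
    (hσ : σ.IsOptimal) (hpv : p < v) (hp : revenueCurve D p ≤ revenueCurve D v / 2) :
    IsBestResponse σ D (lottery p (1 / 2) hz) (lottery v 1 (by simp)) := by
  intro B
  refine le_trans ?_ (le_revB_postedPrice hf hσ hpv)
  obtain ⟨x, hx⟩ := hσ.exists_greatestSelection B
  obtain ⟨m, hm0, hm⟩ := hf.exists_supergradient hreg hv hv1 p.coe_nonneg (by exact_mod_cast hpv)
  rcases revB_dichotomy (hz := hz) hf hD hσ hv hx hm0 hm hp with h | ⟨t, ht, -, h⟩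
  · exact h.trans (ENNReal.ofReal_le_ofReal hp)
  · refine h.trans (ENNReal.ofReal_le_ofReal ?_)
    have h0 : 0 ≤ (t + p) / 2 := by linarith [p.coe_nonneg]
    linarith [mul_nonneg (sub_nonneg.2 hp) (hx.1 _ h0).1.1]

/-- If Alice's price yields less than half the optimal revenue, then under every best response of
Bob all buyers whose value exceeds Alice's price take her lottery. -/
theorem le_revA_of_isBestResponse (hf : IsDensity D f) (hD : D (Iio 0) = 0)
    (hreg : IsRegularDist D f ∨ IsDMRDist D f)
    (hv : ∀ z, 0 ≤ z → revenueCurve D z ≤ revenueCurve D v) (hv0 : 0 < revenueCurve D v)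
    (hv1 : cdf D v < 1)
    (hσ : σ.IsOptimal) (hpv : p < v) (hp : revenueCurve D p < revenueCurve D v / 2)
    {B : Mechanism} (hB : IsBestResponse σ D (lottery p (1 / 2) hz) B) :
    ENNReal.ofReal (revenueCurve D p / 2) ≤ revA σ D (lottery p (1 / 2) hz) B := by
  obtain ⟨x, hx⟩ := hσ.exists_greatestSelection B
  obtain ⟨m, hm0, hm⟩ := hf.exists_supergradient hreg hv hv1 p.coe_nonneg (by exact_mod_cast hpv)
  have hlow := (le_revB_postedPrice (hz := hz) hf hσ hpv).trans (hB _)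
  have hhalf : 0 < revenueCurve D v / 2 := half_pos hv0
  refine le_revA_of_forall hf hσ hx fun w hw => ?_
  -- Bob can secure Γ(v)/2 with the posted price `v`. This excludes the first alternative, and in
  -- the second it forces the option chosen at (t + p)/2 to be 0, hence also at all smaller
  -- effective values.
  rcases revB_dichotomy (hz := hz) hf hD hσ hv hx hm0 hm hp.le with h | ⟨t, ht, hgt, h⟩
  · have := (ENNReal.ofReal_le_ofReal_iff'.1 (hlow.trans h)).resolve_right (not_le.2 hhalf)
    linarith
  · rcases lt_or_ge t w with htw | htw
    · exact Or.inr (hgt w htw)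
    · left
      have h1 := (ENNReal.ofReal_le_ofReal_iff'.1 (hlow.trans h)).resolve_right (not_le.2 hhalf)
      have h0 : 0 ≤ (t + p) / 2 := by linarith [p.coe_nonneg]
      have hw0 : 0 ≤ (w + p) / 2 := by linarith [p.coe_nonneg]
      have h2 : x ((t + p) / 2) ≤ 0 := by
        by_contra! h3
        linarith [mul_pos (sub_pos.2 hp) h3]
      have h3 := hx.1.monotoneOn (mem_Ici.2 hw0) (mem_Ici.2 h0) (by linarith)
      exact le_antisymm (h3.trans h2) (hx.1 _ hw0).1.1

end BestResponse

/-! ### Alice's price and the theorem -/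

theorem ENNReal.ofReal_le_of_forall_sub_le {c : ℝ} {y : ℝ≥0∞}
    (h : ∀ ε : ℝ, 0 < ε → ENNReal.ofReal (c - ε) ≤ y) : ENNReal.ofReal c ≤ y := by
  have hlim : Tendsto (fun ε : ℝ => ENNReal.ofReal (c - ε)) (𝓝[>] 0) (𝓝 (ENNReal.ofReal c)) := by
    have : Continuous fun ε : ℝ => ENNReal.ofReal (c - ε) :=
      ENNReal.continuous_ofReal.comp (continuous_const.sub continuous_id)
    have h0 := (this.tendsto 0).mono_left (nhdsWithin_le_nhds (s := Ioi 0))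
    rwa [sub_zero] at h0
  exact le_of_tendsto hlim (by filter_upwards [self_mem_nhdsWithin] with ε hε using h ε hε)

/-- There is a smallest price that yields half the optimal revenue. -/
theorem IsDensity.exists_isLeast_half {D : Measure ℝ} [IsProbabilityMeasure D] {f : ℝ → ℝ}
    (hf : IsDensity D f) {v : ℝ≥0} (hv0 : 0 < revenueCurve D v) :
    ∃ p : ℝ≥0, IsLeast {q : ℝ≥0 | q ≤ v ∧ revenueCurve D q = revenueCurve D v / 2} p ∧
      0 < p ∧ p < v ∧ ∀ q : ℝ≥0, q < p → revenueCurve D q < revenueCurve D v / 2 := by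
  have hcont : Continuous fun q : ℝ≥0 => revenueCurve D q :=
    hf.continuous_revenueCurve.comp NNReal.continuous_coe
  have hzero : revenueCurve D ((0 : ℝ≥0) : ℝ) = 0 := by simp [revenueCurve]
  have hivt : ∀ u : ℝ≥0, revenueCurve D v / 2 ≤ revenueCurve D u →
      ∃ q ≤ u, revenueCurve D q = revenueCurve D v / 2 := by
    intro u hu
    obtain ⟨q, hq, hq'⟩ := intermediate_value_Icc (a := (0 : ℝ≥0)) (b := u) (zero_le)
      hcont.continuousOn ⟨(by rw [hzero]; linarith :
        revenueCurve D ((0 : ℝ≥0) : ℝ) ≤ revenueCurve D v / 2), hu⟩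
    exact ⟨q, hq.2, hq'⟩
  have hcomp : IsCompact {q : ℝ≥0 | q ≤ v ∧ revenueCurve D q = revenueCurve D v / 2} := by
    refine (isCompact_Icc (a := (0 : ℝ≥0)) (b := v)).of_isClosed_subset ?_
      (fun q hq => ⟨zero_le, hq.1⟩)
    exact (isClosed_Iic (a := v)).inter (isClosed_eq hcont continuous_const)
  obtain ⟨p, hp⟩ := hcomp.exists_isLeast (hivt v (by linarith))
  refine ⟨p, hp, ?_, ?_, fun q hq => ?_⟩
  · rw [pos_iff_ne_zero]
    rintro rfl
    have := hp.1.2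
    rw [hzero] at this
    linarith
  · refine lt_of_le_of_ne hp.1.1 ?_
    rintro rfl
    linarith [hp.1.2]
  · by_contra! h
    obtain ⟨r, hr, hr'⟩ := hivt q h
    exact absurd (hp.2 ⟨hr.trans (hq.le.trans hp.1.1), hr'⟩) (not_le.2 (hr.trans_lt hq))

theorem theorem3p1
    (D : Measure ℝ) [IsProbabilityMeasure D] (hD : D (Set.Iio 0) = 0)
    (f : ℝ → ℝ) (hf : IsDensity D f)
    (hreg : IsRegularDist D f ∨ IsDMRDist D f)
    (v : ℝ≥0) (hv : ∀ z : ℝ≥0, revenueCurve D z ≤ revenueCurve D v)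
    (σ : BuyerRule) (hσ : σ.IsOptimal) :
    monopolyRev D = ENNReal.ofReal (revenueCurve D v) ∧
    (∃ p : ℝ≥0,
      IsLeast {q : ℝ≥0 | q ≤ v ∧ revenueCurve D q = revenueCurve D v / 2} p ∧
      (∃ B : Mechanism,
        IsBestResponse σ D (lottery p (1 / 2) (by norm_num)) B ∧
        ENNReal.ofReal (revenueCurve D v / 4)
          ≤ revA σ D (lottery p (1 / 2) (by norm_num)) B ∧
        ENNReal.ofReal (revenueCurve D v / 2)
          ≤ revB σ D (lottery p (1 / 2) (by norm_num)) B) ∧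
      (∀ ε : ℝ, 0 < ε → ∃ δ : ℝ, 0 < δ ∧ ∀ p' : ℝ≥0, (p : ℝ) - δ < p' → p' < p →
        (∃ B : Mechanism, IsBestResponse σ D (lottery p' (1 / 2) (by norm_num)) B) ∧
        ∀ B : Mechanism, IsBestResponse σ D (lottery p' (1 / 2) (by norm_num)) B →
          ENNReal.ofReal (revenueCurve D v / 4 - ε)
            ≤ revA σ D (lottery p' (1 / 2) (by norm_num)) B ∧
          ENNReal.ofReal (revenueCurve D v / 2 - ε)
            ≤ revB σ D (lottery p' (1 / 2) (by norm_num)) B)) ∧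
    ENNReal.ofReal (revenueCurve D v / 4) ≤ stackelbergRev σ D ∧
    (∀ (A : Mechanism) (R : Mechanism → Mechanism), IsStackelbergEquilibrium σ D A R →
      ENNReal.ofReal (revenueCurve D v / 4) ≤ revA σ D A (R A)) := by
  have hv' : ∀ z, 0 ≤ z → revenueCurve D z ≤ revenueCurve D v := fun z hz0 => hv ⟨z, hz0⟩
  obtain ⟨z, hzpos⟩ := hf.exists_revenueCurve_pos hD
  have hv0 : 0 < revenueCurve D v := hzpos.trans_le (hv z)
  have hv1 : cdf D v < 1 := by
    by_contra! h
    have : revenueCurve D v ≤ 0 :=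
      mul_nonpos_of_nonneg_of_nonpos v.coe_nonneg (by linarith)
    linarith
  obtain ⟨p, hp, hp0, hpv, hlt⟩ := hf.exists_isLeast_half hv0
  have hbest : ∀ q : ℝ≥0, q ≤ p →
      IsBestResponse σ D (lottery q (1 / 2) (by norm_num)) (lottery v 1 (by simp)) := by
    intro q hq
    refine isBestResponse_postedPrice hf hD hreg hv' hv1 hσ (hq.trans_lt hpv) ?_
    rcases hq.eq_or_lt with rfl | h
    · exact hp.1.2.le
    · exact (hlt q h).le
  have hA : ENNReal.ofReal (revenueCurve D v / 4)
      ≤ revA σ D (lottery p (1 / 2) (by norm_num)) (lottery v 1 (by simp)) := by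
    have h := le_revA_postedPrice (hz := by norm_num) hf hσ hpv
    rw [hp.1.2] at h
    convert h using 2
    ring
  have happrox : ∀ ε : ℝ, 0 < ε → ∃ δ : ℝ, 0 < δ ∧ ∀ p' : ℝ≥0, (p : ℝ) - δ < p' → p' < p →
      (∃ B : Mechanism, IsBestResponse σ D (lottery p' (1 / 2) (by norm_num)) B) ∧
      ∀ B : Mechanism, IsBestResponse σ D (lottery p' (1 / 2) (by norm_num)) B →
        ENNReal.ofReal (revenueCurve D v / 4 - ε)
          ≤ revA σ D (lottery p' (1 / 2) (by norm_num)) B ∧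
        ENNReal.ofReal (revenueCurve D v / 2 - ε)
          ≤ revB σ D (lottery p' (1 / 2) (by norm_num)) B := by
    intro ε hε
    obtain ⟨δ, hδ, hδ'⟩ := Metric.continuous_iff.1 hf.continuous_revenueCurve p ε hε
    refine ⟨δ, hδ, fun p' h1 h2 => ⟨⟨_, hbest p' h2.le⟩, fun B hB => ⟨?_, ?_⟩⟩⟩
    · refine le_trans (ENNReal.ofReal_le_ofReal ?_)
        (le_revA_of_isBestResponse hf hD hreg hv' hv0 hv1 hσ (h2.trans hpv) (hlt p' h2) hB)
      have h2' : (p' : ℝ) < p := by exact_mod_cast h2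
      have h3 := hδ' p' (by rw [Real.dist_eq, abs_lt]; constructor <;> linarith)
      rw [Real.dist_eq, abs_lt, hp.1.2] at h3
      linarith [h3.1]
    · refine le_trans (ENNReal.ofReal_le_ofReal (by linarith))
        ((le_revB_postedPrice hf hσ (h2.trans hpv)).trans (hB _))
  refine ⟨hf.monopolyRev_eq hD hv', ⟨p, hp, ⟨lottery v 1 (by simp), hbest p le_rfl, hA,
    le_revB_postedPrice hf hσ hpv⟩, happrox⟩, ?_, ?_⟩
  · exact le_iSup₂_of_le (lottery p (1 / 2) (by norm_num)) (lottery v 1 (by simp))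
      (le_iSup_of_le (hbest p le_rfl) hA)
  · intro A R hAR
    -- Against the price `p` itself, `R` might select a best response that is bad for Alice.
    -- Slightly lower prices bind every best response, so her equilibrium revenue is at least Γ(v)/4
    -- - ε for each ε.
    refine ENNReal.ofReal_le_of_forall_sub_le fun ε hε => ?_
    obtain ⟨δ, hδ, h⟩ := happrox ε hε
    obtain ⟨r, h1, h2⟩ := exists_between
      (show max ((p : ℝ) - δ) 0 < p from max_lt (by linarith) (by exact_mod_cast hp0))
    have hr0 : 0 ≤ r := (le_max_right _ _).trans h1.le
    have h3 := (h ⟨r, hr0⟩ ((le_max_left _ _).trans_lt h1) h2).2 _ (hAR.1 _)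
    exact h3.1.trans (hAR.2 _)
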